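/- **Setting.** Let $0<T<\infty$ and let $(\Omega,\mathcal F,(\mathcal F_t)_{0\le t\le T},\mathrm P)$ be a filtered probability space with a right-continuous filtration such that every set in $\mathcal F_0$ has probability $0$ or $1$ and $\mathcal F_0$ contains all $A\in\mathcal F$ with $\mathrm P(A)=0$. Let $\Phi:[0,\infty)\to[0,\infty]$ be a lower semicontinuous convex function such that $$1\in\operatorname{int}\{\Phi<\infty\},\qquad \inf_{x\ge0}\Phi(x)=0,\qquad \lim_{x\to\infty}\frac{\Phi(x)}{x}=\infty ,$$ and let $\Phi^*(y)=\sup_{x\ge 0}(xy-\Phi(x))$, $y\in\mathbb R$, be its (finite) Fenchel–Legendre transform. Let $H^{\Phi^*}$ be the set of all random variables $X$ (identified when $\mathrm P$-a.s. equal) with $\mathbb E[\Phi^*(c|X|)]<\infty$ for all $c>0$. Let $(Y_t)_{t\in[0,T]}$ be a nonnegative, right-continuous, $(\mathcal F_t)$-adapted real-valued process. Let $\mathcal T$ be the set of all $(\mathcal F_t)$-stopping times with values in $[0,T]$, and let $\mathcal T^r$ be the set of randomized stopping times, that is, of all maps $\tau^r:\Omega\times[0,1]\to[0,T]$ which are nondecreasing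 and left-continuous in the second variable and such that $\tau^r(\cdot,u)\in\mathcal T$ for every $u\in[0,1]$. For $\tau^r\in\mathcal T^r$ write $Y^r_{\tau^r}(\omega,u)=Y_{\tau^r(\omega,u)}(\omega)$; expectations of such variables are taken under the product of $\mathrm P$ and the uniform distribution on $[0,1]$. The process $Y$ is called quasi-left-continuous if $Y_{\tau_n}\to Y_\tau$ $\mathrm P$-a.s. whenever $(\tau_n)_{n\in\mathbb N}$ is a nondecreasing sequence in $\mathcal T$ that converges pointwise to some $\tau\in\mathcal T$. **Proposition.** Suppose that $\sup_{t\in[0,T]}Y_t\in H^{\Phi^*}$ (in particular, this supremum is $\mathrm P$-a.s. finite). Then $\Phi^*(x+Y^r_{\tau^r})-x$ is integrable for all $\tau^r\in\mathcal T^r$ and $x\in\mathbb R$, and $$\sup_{\tau^r\in\mathcal T^r}\inf_{x\in\mathbb R}\mathbb E\big[\Phi^*(x+Y^r_{\tau^r})-x\big]=\inf_{x\in\mathbb R}\sup_{\tau^r\in\mathcal T^r}\mathbb E\big[\Phi^*(x+Y^r_{\tau^r})-x\big].$$ If, moreover, $Y$ is quasi-left-continuous and $\mathcal F_T$ is countably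 generated, then there exist $\tau^{r*}\in\mathcal T^r$ and $x^*\in\mathbb R$ such that, for all $x\in\mathbb R$ and all $\tau^r\in\mathcal T^r$, $$\mathbb E\big[\Phi^*(x^*+Y^r_{\tau^r})-x^*\big]\le\mathbb E\big[\Phi^*(x^*+Y^r_{\tau^{r*}})-x^*\big]\le\mathbb E\big[\Phi^*(x+Y^r_{\tau^{r*}})-x\big].$$ -/

import Mathlib

open MeasureTheory Filter Topology
open scoped NNReal ENNReal

/-- The standing conditions on the divergence function `Φ : [0,∞) → [0,∞]`. -/
structure IsDivergenceFunction (Φ : ℝ≥0 → ℝ≥0∞) : Prop where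
  lowerSemicontinuous : LowerSemicontinuous Φ
  convex : ConvexOn ℝ≥0 Set.univ Φ
  one_mem_interior_dom : (1 : ℝ≥0) ∈ interior {x | Φ x < ∞}
  iInf_eq_zero : ⨅ x, Φ x = 0
  tendsto_div : Tendsto (fun x : ℝ≥0 => Φ x / (x : ℝ≥0∞)) atTop (𝓝 ∞)

/-- The Fenchel-Legendre transform `Φ*(y) = sup_{x ≥ 0} (x y - Φ(x))`, for `y` real, as an
extended real number. -/
noncomputable def fenchelConj (Φ : ℝ≥0 → ℝ≥0∞) (y : ℝ) : EReal :=
  ⨆ x : ℝ≥0, (((x : ℝ) * y : ℝ) : EReal) - ((Φ x : ℝ≥0∞) : EReal)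

/-- The Fenchel-Legendre transform as a real-valued function. Under the standing conditions on `Φ`
nothing is lost, see `IsDivergenceFunction.coe_fenchelConjReal`. -/
noncomputable def fenchelConjReal (Φ : ℝ≥0 → ℝ≥0∞) (y : ℝ) : ℝ := (fenchelConj Φ y).toReal

theorem IsDivergenceFunction.coe_fenchelConjReal {Φ : ℝ≥0 → ℝ≥0∞} (hΦ : IsDivergenceFunction Φ)
    (y : ℝ) : ((fenchelConjReal Φ y : ℝ) : EReal) = fenchelConj Φ y := by
  have hbot : fenchelConj Φ y ≠ ⊥ := by
    have h1 : (1 : ℝ≥0) ∈ {x | Φ x < ∞} := interior_subset hΦ.one_mem_interior_dom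
    have h1 : Φ 1 < ∞ := h1
    refine ne_bot_of_le_ne_bot (b := ((((1 : ℝ≥0) : ℝ) * y : ℝ) : EReal) - ((Φ 1 : ℝ≥0∞) : EReal))
      ?_ (le_iSup (fun x : ℝ≥0 => (((x : ℝ) * y : ℝ) : EReal) - ((Φ x : ℝ≥0∞) : EReal)) 1)
    lift Φ 1 to ℝ≥0 using h1.ne with a
    exact EReal.coe_ne_bot (((1 : ℝ≥0) : ℝ) * y - (a : ℝ))
  have htop : fenchelConj Φ y ≠ ⊤ := by
    obtain ⟨N, hN⟩ := eventually_atTop.1 (hΦ.tendsto_div.eventually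
      (lt_mem_nhds (ENNReal.ofReal_lt_top (r := |y|))))
    refine ne_top_of_le_ne_top (EReal.coe_ne_top ((N : ℝ) * |y|)) (iSup_le fun x => ?_)
    have hxy : (x : ℝ) * y ≤ (x : ℝ) * |y| := mul_le_mul_of_nonneg_left (le_abs_self y) x.2
    rcases le_total x N with hx | hx
    · have h2 : (x : ℝ) * |y| ≤ (N : ℝ) * |y| :=
        mul_le_mul_of_nonneg_right (by exact_mod_cast hx) (abs_nonneg y)
      refine (EReal.sub_le_of_le_add' ?_)
      calc (((x : ℝ) * y : ℝ) : EReal) ≤ (((N : ℝ) * |y| : ℝ) : EReal) := by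
            exact_mod_cast hxy.trans h2
        _ = 0 + (((N : ℝ) * |y| : ℝ) : EReal) := (zero_add _).symm
        _ ≤ _ := by gcongr; exact EReal.coe_ennreal_nonneg _
    · have h3 := hN x hx
      have h4 : ENNReal.ofReal ((x : ℝ) * |y|) ≤ Φ x := by
        rw [ENNReal.ofReal_mul (NNReal.coe_nonneg x), mul_comm, ENNReal.ofReal_coe_nnreal]
        exact ENNReal.mul_le_of_le_div h3.le
      have h5 : (((x : ℝ) * |y| : ℝ) : EReal) ≤ ((Φ x : ℝ≥0∞) : EReal) := by
        refine le_trans ?_ (EReal.coe_ennreal_le_coe_ennreal_iff.2 h4)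
        rw [EReal.coe_ennreal_ofReal, max_eq_left (mul_nonneg (NNReal.coe_nonneg x) (abs_nonneg y))]
      refine (EReal.sub_le_of_le_add' ?_)
      have h6 : (((x : ℝ) * y : ℝ) : EReal) ≤ ((Φ x : ℝ≥0∞) : EReal) :=
        le_trans (by exact_mod_cast hxy) h5
      calc _ ≤ ((Φ x : ℝ≥0∞) : EReal) := h6
        _ = ((Φ x : ℝ≥0∞) : EReal) + 0 := (add_zero _).symm
        _ ≤ _ := by
          gcongr
          exact_mod_cast mul_nonneg N.2 (abs_nonneg y)
  exact EReal.coe_toReal htop hbot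

/-- The Young function `Φ*` restricted to `[0,∞)`. -/
noncomputable def youngConj (Φ : ℝ≥0 → ℝ≥0∞) (y : ℝ≥0) : ℝ≥0∞ := (fenchelConj Φ y).toENNReal

/-- `X` belongs to the Orlicz heart `H^Ψ`: it is a random variable with `E[Ψ(c|X|)] < ∞` for all
`c > 0`. -/
def MemOrliczHeart {Ω : Type*} {mΩ : MeasurableSpace Ω} (Ψ : ℝ≥0 → ℝ≥0∞) (X : Ω → ℝ)
    (μ : Measure Ω) : Prop :=
  AEMeasurable X μ ∧ ∀ c : ℝ≥0, 0 < c → ∫⁻ ω, Ψ (c * ‖X ω‖₊) ∂μ < ∞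

/-- Stopping times with values in `[0,T]`. -/
def stoppingTimes {Ω : Type*} {mΩ : MeasurableSpace Ω} {T : ℝ}
    (𝓕 : Filtration (Set.Icc (0 : ℝ) T) mΩ) : Set (Ω → Set.Icc (0 : ℝ) T) :=
  {τ | IsStoppingTime 𝓕 (fun ω => (τ ω : WithTop (Set.Icc (0 : ℝ) T)))}

/-- Randomized stopping times with values in `[0,T]`: maps on `Ω × [0,1]` that are nondecreasing and
left-continuous in the second variable, and a stopping time for each fixed second variable. -/
def randomizedStoppingTimes {Ω : Type*} {mΩ : MeasurableSpace Ω} {T : ℝ}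
    (𝓕 : Filtration (Set.Icc (0 : ℝ) T) mΩ) : Set (Ω → unitInterval → Set.Icc (0 : ℝ) T) :=
  {τ | (∀ ω, Monotone (τ ω)) ∧
    (∀ ω u, ContinuousWithinAt (τ ω) (Set.Iic u) u) ∧
    ∀ u, (fun ω => τ ω u) ∈ stoppingTimes 𝓕}

/-- Quasi-left-continuity: `Y_{τₙ} → Y_τ` almost surely whenever the stopping times `τₙ` increase
to the stopping time `τ`. -/
def IsQuasiLeftContinuous {Ω : Type*} {mΩ : MeasurableSpace Ω} {T : ℝ}
    (𝓕 : Filtration (Set.Icc (0 : ℝ) T) mΩ) (Y : Set.Icc (0 : ℝ) T → Ω → ℝ)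
    (μ : Measure Ω) : Prop :=
  ∀ (τs : ℕ → Ω → Set.Icc (0 : ℝ) T) (τ : Ω → Set.Icc (0 : ℝ) T),
    (∀ n, τs n ∈ stoppingTimes 𝓕) → τ ∈ stoppingTimes 𝓕 →
    (∀ ω, Monotone (fun n => τs n ω)) →
    (∀ ω, Tendsto (fun n => τs n ω) atTop (𝓝 (τ ω))) →
    ∀ᵐ ω ∂μ, Tendsto (fun n => Y (τs n ω) ω) atTop (𝓝 (Y (τ ω) ω))

/-- The random variable `Φ*(x + Y^r_{τ^r}) - x` on `Ω × [0,1]`, where `Y^r_t(ω,u) = Y_t(ω)`. -/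
noncomputable def randomizedPayoff {Ω : Type*} {T : ℝ} (Φ : ℝ≥0 → ℝ≥0∞)
    (Y : Set.Icc (0 : ℝ) T → Ω → ℝ) (τ : Ω → unitInterval → Set.Icc (0 : ℝ) T) (x : ℝ) :
    Ω × unitInterval → ℝ :=
  fun p => fenchelConjReal Φ (x + Y (τ p.1 p.2) p.1) - x

/-- `E[Φ*(x + Y^r_{τ^r}) - x]`, the expectation being taken under the product of `μ` and the uniform
distribution on `[0,1]`. -/
noncomputable def randomizedValue {Ω : Type*} {mΩ : MeasurableSpace Ω} {T : ℝ} (Φ : ℝ≥0 → ℝ≥0∞)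
    (Y : Set.Icc (0 : ℝ) T → Ω → ℝ) (μ : Measure Ω)
    (τ : Ω → unitInterval → Set.Icc (0 : ℝ) T) (x : ℝ) : ℝ :=
  ∫ p, randomizedPayoff Φ Y τ x p ∂(μ.prod (volume : Measure unitInterval))

/-! ### Stopping times with values in a compact interval -/

section StoppingTimes

variable {Ω : Type*} {mΩ : MeasurableSpace Ω} {T : ℝ} {𝓕 : Filtration (Set.Icc (0 : ℝ) T) mΩ}

/-! For fixed `τ` the value is convex in `x`, and since `Φ` is finite on both sides of `1` it
dominates `δ|x| - C` uniformly in `τ`; only a compact interval of `x` matters. The value depends on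
`τ` only through the conditional law of `τ(ω, ·)`, linearly. Averaging two adapted conditional
distribution functions and taking the left-continuous inverse gives a randomized stopping time again
(`exists_mixture`), so the values form a convex set of functions of `x`. Sion's theorem then gives
the minimax identity.

For the saddle point, `x'` minimizes a lower semicontinuous supremum over a compact interval. On the
other side, the nearly optimal randomized stopping times form decreasing families that are stable
under mixing. Elements of almost minimal L² norm are Cauchy by the parallelogram law, so their
conditional distribution functions converge almost everywhere along a suitable choice
(`exists_ae_tendsto_of_midpoint`); the inverses then converge for almost every level `u`
(`exists_tendsto_of_tendsto_stopCdf`).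

For fixed `u` this is an almost surely convergent, not necessarily monotone, sequence of stopping
times. Quasi-left-continuity still gives convergence of `Y` along it
(`IsQuasiLeftContinuous.ae_tendsto`), because it forces paths to have left limits. Dominated
convergence, with a bound supplied by the Orlicz heart, carries optimality to the limit. -/

theorem mem_stoppingTimes_iff {τ : Ω → Set.Icc (0 : ℝ) T} :
    τ ∈ stoppingTimes 𝓕 ↔ ∀ t, MeasurableSet[𝓕 t] {ω | τ ω ≤ t} := by
  refine forall_congr' fun t => ?_
  simp only [WithTop.coe_le_coe]

theorem measurableSet_lt_of_mem_stoppingTimes {τ : Ω → Set.Icc (0 : ℝ) T}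
    (hτ : τ ∈ stoppingTimes 𝓕) (t : Set.Icc (0 : ℝ) T) : MeasurableSet[𝓕 t] {ω | τ ω < t} := by
  have h := IsStoppingTime.measurableSet_lt hτ t
  simpa only [WithTop.coe_lt_coe] using h

theorem measurable_of_mem_stoppingTimes {τ : Ω → Set.Icc (0 : ℝ) T}
    (hτ : τ ∈ stoppingTimes 𝓕) : Measurable τ :=
  measurable_of_Iic fun t => 𝓕.le t _ (mem_stoppingTimes_iff.1 hτ t)

theorem measurable_min_of_mem_stoppingTimes {τ : Ω → Set.Icc (0 : ℝ) T}
    (hτ : τ ∈ stoppingTimes 𝓕) (q : Set.Icc (0 : ℝ) T) :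
    Measurable[𝓕 q] fun ω => min (τ ω) q := by
  refine measurable_of_Iic (mδ := 𝓕 q) fun t => ?_
  rcases le_total q t with h | h
  · have : (fun ω => min (τ ω) q) ⁻¹' Set.Iic t = Set.univ := by
      ext ω; simp [h]
    rw [this]; exact @MeasurableSet.univ _ (𝓕 q)
  · rcases h.eq_or_lt with rfl | h
    · have : (fun ω => min (τ ω) t) ⁻¹' Set.Iic t = Set.univ := by
        ext ω; simp
      rw [this]; exact @MeasurableSet.univ _ (𝓕 t)
    have : (fun ω => min (τ ω) q) ⁻¹' Set.Iic t = {ω | τ ω ≤ t} := by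
      ext ω; simp [h]
    rw [this]
    exact 𝓕.mono h.le _ (mem_stoppingTimes_iff.1 hτ t)

theorem const_mem_stoppingTimes (t : Set.Icc (0 : ℝ) T) :
    (fun _ : Ω => t) ∈ stoppingTimes 𝓕 :=
  isStoppingTime_const 𝓕 t

variable [Fact (0 ≤ T)]

theorem mem_stoppingTimes_of_lt [𝓕.IsRightContinuous] {τ : Ω → Set.Icc (0 : ℝ) T}
    (h : ∀ t, MeasurableSet[𝓕 t] {ω | τ ω < t}) : τ ∈ stoppingTimes 𝓕 := by
  refine isStoppingTime_of_measurableSet_lt_of_isRightContinuous' (fun t => ?_) fun t ht => ?_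
  · simpa only [WithTop.coe_lt_coe] using h t
  -- Only the right endpoint has an empty right neighbourhood, and there `{τ = ⊤}` is the complement
  -- of `{τ < ⊤}`.
  · have htop : t = ⊤ := by
      by_contra hne
      exact (nhdsGT_neBot_of_exists_gt ⟨⊤, lt_top_iff_ne_top.2 hne⟩).ne ht
    have : {ω | ((τ ω : Set.Icc (0 : ℝ) T) : WithTop (Set.Icc (0 : ℝ) T)) = t} =
        {ω | τ ω < t}ᶜ := by
      ext ω
      simp [htop]
    rw [this]
    exact (h t).compl

theorem iSup_mem_stoppingTimes {τ : ℕ → Ω → Set.Icc (0 : ℝ) T}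
    (h : ∀ n, τ n ∈ stoppingTimes 𝓕) : (fun ω => ⨆ n, τ n ω) ∈ stoppingTimes 𝓕 := by
  refine mem_stoppingTimes_iff.2 fun t => ?_
  simp only [iSup_le_iff, Set.ofPred_forall]
  exact MeasurableSet.iInter fun n => mem_stoppingTimes_iff.1 (h n) t

theorem iInf_mem_stoppingTimes [𝓕.IsRightContinuous] {τ : ℕ → Ω → Set.Icc (0 : ℝ) T}
    (h : ∀ n, τ n ∈ stoppingTimes 𝓕) : (fun ω => ⨅ n, τ n ω) ∈ stoppingTimes 𝓕 := by
  refine mem_stoppingTimes_of_lt fun t => ?_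
  simp only [iInf_lt_iff, Set.ofPred_exists]
  exact MeasurableSet.iUnion fun n => measurableSet_lt_of_mem_stoppingTimes (h n) t

end StoppingTimes

/-! ### Measurability of right-continuous processes -/

section RightContinuous

/-- A process with right-continuous paths is jointly measurable. -/
theorem measurable_uncurry_of_continuousWithinAt_Ici {Ω : Type*} [MeasurableSpace Ω] {T : ℝ}
    [hT : Fact (0 ≤ T)] {Z : Set.Icc (0 : ℝ) T → Ω → ℝ} (hZ : ∀ t, Measurable (Z t))
    (hZr : ∀ ω t, ContinuousWithinAt (fun s => Z s ω) (Set.Ici t) t) :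
    Measurable fun p : Set.Icc (0 : ℝ) T × Ω => Z p.1 p.2 := by
  -- Time is rounded up to `(⌊(n+1)t⌋ + 1)/(n+1)`, clipped to `[0,T]`. This is never below `t`, so
  -- right-continuity applies, and it has countably many values.
  let g : ℕ → ℤ → Set.Icc (0 : ℝ) T :=
    fun n k => Set.projIcc 0 T hT.out (((k : ℝ) + 1) / ((n : ℝ) + 1))
  let d : ℕ → Set.Icc (0 : ℝ) T → ℤ := fun n t => ⌊((n : ℝ) + 1) * (t : ℝ)⌋
  have hd : ∀ n, Measurable (d n) := fun n =>
    Int.measurable_floor.comp (measurable_subtype_coe.const_mul _)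
  refine measurable_of_tendsto_metrizable
    (f := fun n (p : Set.Icc (0 : ℝ) T × Ω) => Z (g n (d n p.1)) p.2) (fun n => ?_) ?_
  · have h1 : Measurable fun q : ℤ × Ω => Z (g n q.1) q.2 :=
      measurable_from_prod_countable_right fun k => hZ (g n k)
    have h2 : Measurable fun p : Set.Icc (0 : ℝ) T × Ω => (d n p.1, p.2) :=
      ((hd n).comp measurable_fst).prodMk measurable_snd
    have h3 : Measurable ((fun q : ℤ × Ω => Z (g n q.1) q.2) ∘
      fun p : Set.Icc (0 : ℝ) T × Ω => (d n p.1, p.2)) := h1.comp h2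
    exact h3
  · rw [tendsto_pi_nhds]
    rintro ⟨t, ω⟩
    refine (hZr ω t).tendsto.comp (tendsto_nhdsWithin_iff.2 ⟨?_, Eventually.of_forall fun n => ?_⟩)
    · have h1 : Tendsto (fun n : ℕ => (((d n t : ℤ) : ℝ) + 1) / ((n : ℝ) + 1)) atTop
          (𝓝 (t : ℝ)) := by
        have h2 : Tendsto (fun n : ℕ => (t : ℝ) + 1 / ((n : ℝ) + 1)) atTop (𝓝 ((t : ℝ) + 0)) :=
          tendsto_const_nhds.add tendsto_one_div_add_atTop_nhds_zero_nat
        rw [add_zero] at h2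
        refine tendsto_of_tendsto_of_tendsto_of_le_of_le tendsto_const_nhds h2 (fun n => ?_)
          fun n => ?_
        · rw [le_div_iff₀ (by positivity), mul_comm]
          exact (Int.lt_floor_add_one _).le
        · have h3 : (t : ℝ) + 1 / ((n : ℝ) + 1) = (((n : ℝ) + 1) * t + 1) / ((n : ℝ) + 1) := by
            field_simp
          simp only [h3]
          gcongr
          exact Int.floor_le _
      have h2 := (continuous_projIcc (h := hT.out)).continuousAt.tendsto.comp h1
      rwa [Set.projIcc_val] at h2
    · have h1 : (t : ℝ) ≤ (((d n t : ℤ) : ℝ) + 1) / ((n : ℝ) + 1) := by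
        rw [le_div_iff₀ (by positivity), mul_comm]
        exact (Int.lt_floor_add_one _).le
      have h2 := Set.monotone_projIcc hT.out h1
      rwa [Set.projIcc_val] at h2

variable {Ω : Type*} {mΩ : MeasurableSpace Ω} {T : ℝ} [Fact (0 ≤ T)]
  {𝓕 : Filtration (Set.Icc (0 : ℝ) T) mΩ} {Y : Set.Icc (0 : ℝ) T → Ω → ℝ}

/-- The value of a right-continuous adapted process at a stopping time truncated at `q` is known
at time `q`. -/
theorem measurable_apply_min_of_mem_stoppingTimes (hY : Adapted 𝓕 Y)
    (hYr : ∀ ω t, ContinuousWithinAt (fun s => Y s ω) (Set.Ici t) t)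
    {τ : Ω → Set.Icc (0 : ℝ) T} (hτ : τ ∈ stoppingTimes 𝓕) (q : Set.Icc (0 : ℝ) T) :
    Measurable[𝓕 q] fun ω => Y (min (τ ω) q) ω := by
  -- The stopped process `Y (min t q)` is jointly measurable over the σ-algebra `𝓕 q`.
  have h := @measurable_uncurry_of_continuousWithinAt_Ici Ω (𝓕 q) T _
    (fun t ω => Y (min t q) ω) (fun t => (hY _).mono (𝓕.mono (min_le_right t q)) le_rfl)
    fun ω t => by
      refine (hYr ω (min t q)).comp (f := fun s => min s q)
        (continuous_id.min continuous_const).continuousWithinAt fun s hs => ?_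
      exact min_le_min_right q hs
  have h2 := (measurable_min_of_mem_stoppingTimes hτ q).prodMk (@measurable_id Ω (𝓕 q))
  simpa [Function.comp_def] using h.comp h2

theorem measurable_uncurry_of_adapted (hY : Adapted 𝓕 Y)
    (hYr : ∀ ω t, ContinuousWithinAt (fun s => Y s ω) (Set.Ici t) t) :
    Measurable fun p : Set.Icc (0 : ℝ) T × Ω => Y p.1 p.2 :=
  measurable_uncurry_of_continuousWithinAt_Ici (fun t => (hY t).mono (𝓕.le t) le_rfl) hYr

end RightContinuous

/-! ### Oscillations of a right-continuous path -/

section Oscillation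

/-- Vanishing oscillation on the left is the Cauchy criterion for a left limit; the sequence `ρ`
identifies its value. -/
theorem tendsto_nhdsLT_of_oscillation {T : ℝ} {f : Set.Icc (0 : ℝ) T → ℝ}
    {t : Set.Icc (0 : ℝ) T} (ht : ∀ m : ℕ, ∃ s < t, ∀ r ∈ Set.Ioo s t,
      ∀ r' ∈ Set.Ioo s t, |f r - f r'| ≤ 2 * (1 / ((m : ℝ) + 1)))
    {ρ : ℕ → Set.Icc (0 : ℝ) T} (hlt : ∀ n, ρ n < t) (hρ : Tendsto ρ atTop (𝓝 t)) {L : ℝ}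
    (hL : Tendsto (fun n => f (ρ n)) atTop (𝓝 L)) : Tendsto f (𝓝[<] t) (𝓝 L) := by
  rw [Metric.tendsto_nhds]
  intro ε hε
  obtain ⟨m, hm⟩ := exists_nat_one_div_lt (show 0 < ε / 2 by positivity)
  obtain ⟨s, hs, hosc⟩ := ht m
  filter_upwards [Ioo_mem_nhdsLT hs] with r hr
  have h1 : |f r - L| ≤ 2 * (1 / ((m : ℝ) + 1)) := by
    refine le_of_tendsto (tendsto_const_nhds.sub hL).abs ?_
    filter_upwards [hρ.eventually (lt_mem_nhds hs)] with n hn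
    exact hosc r hr _ ⟨hn, hlt n⟩
  rw [Real.dist_eq]
  linarith

variable {T : ℝ} [Fact (0 ≤ T)]

theorem exists_denseSeq_of_eventually_nhdsGT {r t : Set.Icc (0 : ℝ) T} (h : r < t)
    {p : Set.Icc (0 : ℝ) T → Prop} (hp : ∀ᶠ q in 𝓝[>] r, p q) :
    ∃ n, p (TopologicalSpace.denseSeq (Set.Icc (0 : ℝ) T) n) ∧
      r < TopologicalSpace.denseSeq (Set.Icc (0 : ℝ) T) n ∧
      TopologicalSpace.denseSeq (Set.Icc (0 : ℝ) T) n < t := by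
  obtain ⟨u, hu, hsub⟩ := (mem_nhdsGT_iff_exists_Ioo_subset' h).1 hp
  obtain ⟨_, ⟨n, rfl⟩, hn⟩ := (TopologicalSpace.denseRange_denseSeq
    (Set.Icc (0 : ℝ) T)).exists_between (lt_min hu h)
  exact ⟨n, hsub ⟨hn.1, hn.2.trans_le (min_le_left _ _)⟩, hn.1, hn.2.trans_le (min_le_right _ _)⟩

/-- The first time after `s` at which `f` is more than `ε` away from `f s`. -/
noncomputable def oscTime (f : Set.Icc (0 : ℝ) T → ℝ) (ε : ℝ) (s : Set.Icc (0 : ℝ) T) :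
    Set.Icc (0 : ℝ) T :=
  sInf {t | s ≤ t ∧ ε < |f t - f s|}

variable {f : Set.Icc (0 : ℝ) T → ℝ} {ε : ℝ} {s t : Set.Icc (0 : ℝ) T}

theorem le_oscTime : s ≤ oscTime f ε s := le_sInf fun _ h => h.1

theorem abs_sub_le_of_lt_oscTime (hst : s ≤ t) (ht : t < oscTime f ε s) : |f t - f s| ≤ ε := by
  by_contra! h
  exact ht.not_ge (sInf_le ⟨hst, h⟩)

/-- The infimum need not be attained, but the set meets every right neighbourhood of it, so
right-continuity preserves the inequality, without strictness. -/
theorem le_abs_sub_oscTime (hf : ∀ t, ContinuousWithinAt f (Set.Ici t) t) (hst : s ≤ t)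
    (ht : ε < |f t - f s|) : ε ≤ |f (oscTime f ε s) - f s| := by
  by_contra! h
  have h1 : ∀ᶠ r in 𝓝[≥] (oscTime f ε s), |f r - f s| < ε :=
    ((hf (oscTime f ε s)).tendsto.sub_const (f s)).abs.eventually (gt_mem_nhds h)
  have h2 : ∃ᶠ r in 𝓝[≥] (oscTime f ε s), r ∈ {t | s ≤ t ∧ ε < |f t - f s|} :=
    (isGLB_sInf _).frequently_mem ⟨t, hst, ht⟩
  obtain ⟨r, hr1, hr2⟩ := (h2.and_eventually h1).exists
  exact hr1.2.not_gt hr2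

/-- Right-continuity turns an uncountable union into a countable one. The strict `s < q` is
available because, for `ε ≥ 0`, the path at `s` itself does not exceed the threshold. -/
theorem oscTime_lt_iff (hf : ∀ t, ContinuousWithinAt f (Set.Ici t) t) (hε : 0 ≤ ε) :
    oscTime f ε s < t ↔ ∃ n, s < TopologicalSpace.denseSeq (Set.Icc (0 : ℝ) T) n ∧
      TopologicalSpace.denseSeq (Set.Icc (0 : ℝ) T) n < t ∧
      ε < |f (TopologicalSpace.denseSeq (Set.Icc (0 : ℝ) T) n) - f s| := by
  rw [oscTime, sInf_lt_iff]
  constructor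
  · rintro ⟨r, ⟨hsr, hr⟩, hrt⟩
    have hne : s ≠ r := by
      rintro rfl
      simp at hr
      linarith
    have h1 : ∀ᶠ q in 𝓝[≥] r, ε < |f q - f s| :=
      ((hf r).tendsto.sub_const (f s)).abs.eventually (lt_mem_nhds hr)
    obtain ⟨n, h2, h3, h4⟩ := exists_denseSeq_of_eventually_nhdsGT hrt
      (h1.filter_mono (nhdsWithin_mono _ Set.Ioi_subset_Ici_self))
    exact ⟨n, hsr.trans_lt h3, h4, h2⟩
  · rintro ⟨n, h1, h2, h3⟩
    exact ⟨_, ⟨h1.le, h3⟩, h2⟩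

/-- If the oscillations of size `ε` are exhausted by the sequence `κ`, then `f` oscillates by at
most `2 ε` on a left neighbourhood of every point. -/
theorem exists_Ioo_abs_sub_le {κ : ℕ → Set.Icc (0 : ℝ) T} (h0 : κ 0 = ⊥)
    (hκ : ∀ n, κ (n + 1) = oscTime f ε (κ n)) {k : ℕ}
    (hk : ∀ t, κ k ≤ t → |f t - f (κ k)| ≤ ε) (ht : ⊥ < t) :
    ∃ s < t, ∀ r ∈ Set.Ioo s t, ∀ r' ∈ Set.Ioo s t, |f r - f r'| ≤ 2 * ε := by
  -- On `[κ n, t)` every value lies within `ε` of `f (κ n)`, whence `2 * ε`.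
  have key : ∀ n, κ n < t → (∀ r, κ n ≤ r → r < t → |f r - f (κ n)| ≤ ε) →
      ∃ s < t, ∀ r ∈ Set.Ioo s t, ∀ r' ∈ Set.Ioo s t, |f r - f r'| ≤ 2 * ε := by
    intro n hn h
    refine ⟨κ n, hn, fun r hr r' hr' => ?_⟩
    have h1 := h r hr.1.le hr.2
    have h2 := h r' hr'.1.le hr'.2
    rw [abs_le] at *
    constructor <;> linarith
  have ind : ∀ n, t ≤ κ n →
      ∃ s < t, ∀ r ∈ Set.Ioo s t, ∀ r' ∈ Set.Ioo s t, |f r - f r'| ≤ 2 * ε := by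
    intro n
    induction n with
    | zero => exact fun h => absurd (ht.trans_le h) (by simp [h0])
    | succ n ih =>
      intro h
      rcases le_or_gt t (κ n) with h1 | h1
      · exact ih h1
      · exact key n h1 fun r hr hrt =>
          abs_sub_le_of_lt_oscTime hr (hrt.trans_le (h.trans_eq (hκ n)))
  rcases le_or_gt t (κ k) with h1 | h1
  · exact ind k h1
  · exact key k h1 fun r hr _ => hk r hr

end Oscillation

/-! ### Convergence along arbitrary convergent stopping times -/

section QuasiLeftContinuous

variable {Ω : Type*} {mΩ : MeasurableSpace Ω} {T : ℝ} [Fact (0 ≤ T)]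
  {𝓕 : Filtration (Set.Icc (0 : ℝ) T) mΩ} {Y : Set.Icc (0 : ℝ) T → Ω → ℝ}

theorem oscTime_mem_stoppingTimes [𝓕.IsRightContinuous] (hY : Adapted 𝓕 Y)
    (hYr : ∀ ω t, ContinuousWithinAt (fun s => Y s ω) (Set.Ici t) t) {ε : ℝ} (hε : 0 ≤ ε)
    {τ : Ω → Set.Icc (0 : ℝ) T} (hτ : τ ∈ stoppingTimes 𝓕) :
    (fun ω => oscTime (fun t => Y t ω) ε (τ ω)) ∈ stoppingTimes 𝓕 := by
  refine mem_stoppingTimes_of_lt fun t => ?_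
  -- On `{τ < q}` truncating `τ` at `q` changes nothing, and the truncated form is visibly an event
  -- of `𝓕 q`.
  have heq : {ω | oscTime (fun t => Y t ω) ε (τ ω) < t} = ⋃ n : ℕ,
      ⋃ (_ : TopologicalSpace.denseSeq (Set.Icc (0 : ℝ) T) n < t),
        ({ω | τ ω < TopologicalSpace.denseSeq (Set.Icc (0 : ℝ) T) n} ∩
        {ω | ε < |Y (TopologicalSpace.denseSeq (Set.Icc (0 : ℝ) T) n) ω -
          Y (min (τ ω) (TopologicalSpace.denseSeq (Set.Icc (0 : ℝ) T) n)) ω|}) := by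
    ext ω
    simp only [Set.mem_ofPred_eq, oscTime_lt_iff (hYr ω) hε, Set.mem_iUnion, Set.mem_inter_iff]
    refine exists_congr fun n => ⟨fun ⟨h1, h2, h3⟩ => ⟨h2, h1, ?_⟩, fun ⟨h2, h1, h3⟩ => ⟨h1, h2, ?_⟩⟩
    · rwa [min_eq_left h1.le]
    · rwa [min_eq_left h1.le] at h3
  rw [heq]
  refine MeasurableSet.iUnion fun n => MeasurableSet.iUnion fun hn => 𝓕.mono hn.le _ ?_
  refine (measurableSet_lt_of_mem_stoppingTimes hτ _).inter ?_
  have h1 : Measurable[𝓕 (TopologicalSpace.denseSeq (Set.Icc (0 : ℝ) T) n)]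
      (Y (TopologicalSpace.denseSeq (Set.Icc (0 : ℝ) T) n)) := hY _
  have h2 := h1.sub (measurable_apply_min_of_mem_stoppingTimes hY hYr hτ
    (TopologicalSpace.denseSeq (Set.Icc (0 : ℝ) T) n))
  exact h2 (measurableSet_lt measurable_const continuous_abs.measurable :
    MeasurableSet {x : ℝ | ε < |x|})

variable {μ : Measure Ω}

/-- Almost all paths of a quasi-left-continuous right-continuous process have finitely many
oscillations of a given size. -/
theorem IsQuasiLeftContinuous.ae_exists_Ioo_abs_sub_le [𝓕.IsRightContinuous]
    (hq : IsQuasiLeftContinuous 𝓕 Y μ) (hY : Adapted 𝓕 Y)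
    (hYr : ∀ ω t, ContinuousWithinAt (fun s => Y s ω) (Set.Ici t) t) {ε : ℝ} (hε : 0 < ε) :
    ∀ᵐ ω ∂μ, ∀ t : Set.Icc (0 : ℝ) T, ⊥ < t → ∃ s < t, ∀ r ∈ Set.Ioo s t, ∀ r' ∈ Set.Ioo s t,
      |Y r ω - Y r' ω| ≤ 2 * ε := by
  let κ : ℕ → Ω → Set.Icc (0 : ℝ) T := fun n ω => (oscTime (fun t => Y t ω) ε)^[n] ⊥
  have hκs : ∀ n ω, κ (n + 1) ω = oscTime (fun t => Y t ω) ε (κ n ω) := fun n ω =>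
    Function.iterate_succ_apply' _ _ _
  have hκ : ∀ n, κ n ∈ stoppingTimes 𝓕 := by
    intro n
    induction n with
    | zero => exact const_mem_stoppingTimes _
    | succ n ih =>
      have := oscTime_mem_stoppingTimes hY hYr hε.le ih
      simpa only [← hκs] using this
  have hmono : ∀ ω, Monotone fun n => κ n ω := fun ω =>
    monotone_nat_of_le_succ fun n => (le_oscTime).trans_eq (hκs n ω).symm
  filter_upwards [hq κ _ hκ (iSup_mem_stoppingTimes hκ) hmono
    fun ω => tendsto_atTop_iSup (hmono ω)] with ω hω t ht
  -- Otherwise all increments of `Y` along `κ n` are at least `ε`, although quasi-left-continuity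
  -- makes this sequence converge.
  have hk : ∃ k, ∀ t, κ k ω ≤ t → |Y t ω - Y (κ k ω) ω| ≤ ε := by
    by_contra! hcon
    have h1 : ∀ n, ε ≤ |Y (κ (n + 1) ω) ω - Y (κ n ω) ω| := by
      intro n
      obtain ⟨t, ht, ht'⟩ := hcon n
      rw [hκs]
      exact le_abs_sub_oscTime (f := fun t => Y t ω) (hYr ω) ht ht'
    have h2 := ((hω.comp (tendsto_add_atTop_nat 1)).sub hω).abs
    simp only [sub_self, abs_zero] at h2
    exact hε.not_ge (ge_of_tendsto' h2 h1)
  obtain ⟨k, hk⟩ := hk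
  exact exists_Ioo_abs_sub_le (f := fun t => Y t ω) (κ := fun n => κ n ω) rfl
    (fun n => hκs n ω) hk ht

/-- A quasi-left-continuous right-continuous process converges along every almost surely
convergent sequence of stopping times. -/
theorem IsQuasiLeftContinuous.ae_tendsto [𝓕.IsRightContinuous]
    (hq : IsQuasiLeftContinuous 𝓕 Y μ) (hY : Adapted 𝓕 Y)
    (hYr : ∀ ω t, ContinuousWithinAt (fun s => Y s ω) (Set.Ici t) t)
    {σ : ℕ → Ω → Set.Icc (0 : ℝ) T} {σ' : Ω → Set.Icc (0 : ℝ) T}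
    (hσ : ∀ n, σ n ∈ stoppingTimes 𝓕)
    (hlim : ∀ᵐ ω ∂μ, Tendsto (fun n => σ n ω) atTop (𝓝 (σ' ω))) :
    ∀ᵐ ω ∂μ, Tendsto (fun n => Y (σ n ω) ω) atTop (𝓝 (Y (σ' ω) ω)) := by
  -- The tail infima are stopping times by right-continuity of the filtration and increase to
  -- `liminf σ n`, which is `σ'` almost surely.
  have hρ : ∀ n, (fun ω => ⨅ m, σ (m + n) ω) ∈ stoppingTimes 𝓕 := fun n =>
    iInf_mem_stoppingTimes fun m => hσ (m + n)
  have hmono : ∀ ω, Monotone fun n => ⨅ m, σ (m + n) ω := fun ω n n' hn => by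
    refine le_iInf fun m => (iInf_le _ (m + (n' - n))).trans_eq ?_
    rw [show m + (n' - n) + n = m + n' by omega]
  have hosc : ∀ᵐ ω ∂μ, ∀ m : ℕ, ∀ t : Set.Icc (0 : ℝ) T, ⊥ < t → ∃ s < t, ∀ r ∈ Set.Ioo s t,
      ∀ r' ∈ Set.Ioo s t, |Y r ω - Y r' ω| ≤ 2 * (1 / ((m : ℝ) + 1)) :=
    ae_all_iff.2 fun m => hq.ae_exists_Ioo_abs_sub_le hY hYr (by positivity)
  filter_upwards [hlim, hosc, hq _ _ hρ (iSup_mem_stoppingTimes hρ) hmono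
    fun ω => tendsto_atTop_iSup (hmono ω)] with ω h1 h2 h3
  have hsup : ⨆ n, ⨅ m, σ (m + n) ω = σ' ω := by
    rw [← h1.liminf_eq, liminf_eq_iSup_iInf_of_nat']
  rw [hsup] at h3
  have hle : ∀ n, ⨅ m, σ (m + n) ω ≤ σ' ω := fun n => by
    rw [← hsup]; exact le_iSup (fun n => ⨅ m, σ (m + n) ω) n
  -- If some tail infimum reaches `σ'`, the sequence eventually stays on the right of `σ'`.
  -- Otherwise the tail infima approach strictly from the left, so the left limit at `σ'` is `Y (σ'
  -- ω) ω` and the path is continuous there.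
  by_cases hcase : ∃ n, ⨅ m, σ (m + n) ω = σ' ω
  · obtain ⟨n, hn⟩ := hcase
    refine (hYr ω (σ' ω)).tendsto.comp (tendsto_nhdsWithin_iff.2 ⟨h1, ?_⟩)
    filter_upwards [eventually_ge_atTop n] with k hk
    rw [← hn, Set.mem_Ici]
    refine (iInf_le _ (k - n)).trans_eq ?_
    congr 1; omega
  · push Not at hcase
    have hlt : ∀ n, ⨅ m, σ (m + n) ω < σ' ω := fun n => (hle n).lt_of_ne (hcase n)
    have hρlim : Tendsto (fun n => ⨅ m, σ (m + n) ω) atTop (𝓝 (σ' ω)) := by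
      rw [← hsup]; exact tendsto_atTop_iSup (hmono ω)
    have hleft : Tendsto (fun t => Y t ω) (𝓝[<] (σ' ω)) (𝓝 (Y (σ' ω) ω)) :=
      tendsto_nhdsLT_of_oscillation (fun m => h2 m _ (bot_le.trans_lt (hlt 0))) hlt hρlim h3
    have hfull : Tendsto (fun t => Y t ω) (𝓝 (σ' ω)) (𝓝 (Y (σ' ω) ω)) := by
      rw [← nhdsLT_sup_nhdsGE]
      exact hleft.sup (hYr ω (σ' ω)).tendsto
    exact hfull.comp h1

end QuasiLeftContinuous

/-! ### Quantile functions on the time interval -/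

section Quantile

variable {T : ℝ} [Fact (0 ≤ T)]

/-- The left-continuous generalized inverse of a distribution function on `[0,T]`. -/
noncomputable def quantile (a : Set.Icc (0 : ℝ) T → ℝ≥0∞) (u : unitInterval) : Set.Icc (0 : ℝ) T :=
  sInf {t | ENNReal.ofReal u ≤ a t}

variable {a : Set.Icc (0 : ℝ) T → ℝ≥0∞}

/-- Right-continuity makes the infimum attained, over a set that contains `⊤`. Left-continuity,
measurability and the law of the quantile all rest on this equivalence. -/
theorem quantile_le_iff (hmono : Monotone a) (hr : ∀ t, ContinuousWithinAt a (Set.Ici t) t)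
    (htop : a ⊤ = 1) (u : unitInterval) (t : Set.Icc (0 : ℝ) T) :
    quantile a u ≤ t ↔ ENNReal.ofReal u ≤ a t := by
  refine ⟨fun h => ?_, fun h => sInf_le h⟩
  have h1 : ∃ᶠ r in 𝓝[≥] (quantile a u), r ∈ {t | ENNReal.ofReal u ≤ a t} :=
    (isGLB_sInf _).frequently_mem ⟨⊤, by
      simpa [htop] using u.2.2⟩
  exact (ge_of_tendsto_of_frequently (hr _).tendsto h1).trans (hmono h)

theorem monotone_quantile : Monotone (quantile a) := fun _ _ h =>
  sInf_le_sInf fun _ ht => (ENNReal.ofReal_le_ofReal h).trans ht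

theorem continuousWithinAt_quantile (hmono : Monotone a)
    (hr : ∀ t, ContinuousWithinAt a (Set.Ici t) t) (htop : a ⊤ = 1) (u : unitInterval) :
    ContinuousWithinAt (quantile a) (Set.Iic u) u := by
  refine tendsto_order.2 ⟨fun c hc => ?_, fun c hc => ?_⟩
  · have h1 : a c < ENNReal.ofReal u := by
      rwa [← not_le, ← quantile_le_iff hmono hr htop, not_le]
    have h2 : ∀ᶠ v : unitInterval in 𝓝 u, a c < ENNReal.ofReal v :=
      ((ENNReal.continuous_ofReal.comp continuous_subtype_val).tendsto u).eventually
        (lt_mem_nhds h1)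
    filter_upwards [h2.filter_mono nhdsWithin_le_nhds] with v hv
    rwa [← not_le, quantile_le_iff hmono hr htop, not_le]
  · filter_upwards [self_mem_nhdsWithin] with v hv
    exact (monotone_quantile hv).trans_lt hc

theorem volume_setOf_quantile_le (hmono : Monotone a)
    (hr : ∀ t, ContinuousWithinAt a (Set.Ici t) t) (htop : a ⊤ = 1) (t : Set.Icc (0 : ℝ) T) :
    volume {u | quantile a u ≤ t} = a t := by
  have h1 : a t ≤ 1 := htop ▸ hmono le_top
  have h2 : (a t).toReal ≤ 1 := ENNReal.toReal_le_of_le_ofReal zero_le_one (by simpa using h1)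
  have h3 : {u | quantile a u ≤ t} = Set.Iic ⟨(a t).toReal, ENNReal.toReal_nonneg, h2⟩ := by
    ext u
    rw [Set.mem_ofPred_eq, quantile_le_iff hmono hr htop, Set.mem_Iic, ← Subtype.coe_le_coe,
      ENNReal.ofReal_le_iff_le_toReal (h1.trans_lt ENNReal.one_lt_top).ne]
  rw [h3, unitInterval.volume_Iic, ENNReal.ofReal_toReal (h1.trans_lt ENNReal.one_lt_top).ne]

end Quantile

/-! ### Conditional distribution functions and mixtures -/

section Law

variable {Ω : Type*} {mΩ : MeasurableSpace Ω} {T : ℝ}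
  {𝓕 : Filtration (Set.Icc (0 : ℝ) T) mΩ}

/-- The conditional distribution function of a randomized stopping time. -/
noncomputable def stopCdf (τ : Ω → unitInterval → Set.Icc (0 : ℝ) T) (ω : Ω)
    (t : Set.Icc (0 : ℝ) T) : ℝ≥0∞ := volume {u | τ ω u ≤ t}

variable {τ τ₁ τ₂ : Ω → unitInterval → Set.Icc (0 : ℝ) T}

theorem monotone_stopCdf (ω : Ω) : Monotone (stopCdf τ ω) := fun _ _ h =>
  measure_mono fun _ hu => le_trans hu h

theorem stopCdf_le_one (ω : Ω) (t : Set.Icc (0 : ℝ) T) : stopCdf τ ω t ≤ 1 := prob_le_one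

theorem measurable_section (hτ : τ ∈ randomizedStoppingTimes 𝓕) (ω : Ω) : Measurable (τ ω) :=
  (hτ.1 ω).measurable

/-- By monotonicity and left-continuity `{u | τ ω u ≤ t}` is empty or a closed interval starting at
`0`, so its length decides membership. At `u = 0` the left side always holds while the right may
fail. -/
theorem ofReal_le_stopCdf_iff (hτ : τ ∈ randomizedStoppingTimes 𝓕) (ω : Ω)
    (t : Set.Icc (0 : ℝ) T) {u : unitInterval} (hu : 0 < u) :
    ENNReal.ofReal u ≤ stopCdf τ ω t ↔ τ ω u ≤ t := by
  refine ⟨fun h => ?_, fun h => ?_⟩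
  · by_contra! hlt
    have h1 : ∀ᶠ v in 𝓝[≤] u, t < τ ω v := (hτ.2.1 ω u).eventually (lt_mem_nhds hlt)
    obtain ⟨w, hw, hsub⟩ := (mem_nhdsLE_iff_exists_Ioc_subset' hu).1 h1
    obtain ⟨v, hv1, hv2⟩ := exists_between (Set.mem_Iio.1 hw)
    have h2 : {r | τ ω r ≤ t} ⊆ Set.Iic v := fun r hr => by
      by_contra hrv
      have h3 : t < τ ω v := hsub ⟨hv1, hv2.le⟩
      exact (h3.trans_le (hτ.1 ω (not_le.1 hrv).le)).not_ge hr
    have h3 := h.trans (measure_mono h2)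
    rw [unitInterval.volume_Iic, ENNReal.ofReal_le_ofReal_iff v.2.1] at h3
    exact hv2.not_ge h3
  · rw [← unitInterval.volume_Iic]
    exact measure_mono fun v hv => (hτ.1 ω hv).trans h

/-- Superlevel sets at heights in `(0,1]` are the events `{τ(·,u) ≤ t}`; this is where adaptedness
passes from `τ` to its conditional law. -/
theorem measurable_stopCdf (hτ : τ ∈ randomizedStoppingTimes 𝓕) (t : Set.Icc (0 : ℝ) T) :
    Measurable[𝓕 t] fun ω => stopCdf τ ω t := by
  refine measurable_of_Ici (mδ := 𝓕 t) fun c => ?_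
  rcases eq_or_ne c 0 with rfl | hc0
  · simp
  rcases lt_or_ge 1 c with hc1 | hc1
  · have : (fun ω => stopCdf τ ω t) ⁻¹' Set.Ici c = ∅ := by
      ext ω
      simpa using (stopCdf_le_one ω t).trans_lt hc1
    rw [this]; exact @MeasurableSet.empty _ (𝓕 t)
  · have hctop := (hc1.trans_lt ENNReal.one_lt_top).ne
    let u : unitInterval := ⟨c.toReal, ENNReal.toReal_nonneg,
      ENNReal.toReal_le_of_le_ofReal zero_le_one (by simpa using hc1)⟩
    have hu : 0 < u := Subtype.coe_lt_coe.1 (ENNReal.toReal_pos hc0 hctop)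
    have hcu : c = ENNReal.ofReal u := (ENNReal.ofReal_toReal hctop).symm
    have : (fun ω => stopCdf τ ω t) ⁻¹' Set.Ici c = {ω | τ ω u ≤ t} := by
      ext ω
      rw [Set.mem_preimage, Set.mem_Ici, hcu, ofReal_le_stopCdf_iff hτ ω t hu, Set.mem_ofPred_eq]
    rw [this]
    exact mem_stoppingTimes_iff.1 (hτ.2.2 u) t

variable [Fact (0 ≤ T)]

theorem stopCdf_top (ω : Ω) : stopCdf τ ω ⊤ = 1 := by simp [stopCdf]

theorem continuousWithinAt_stopCdf (hτ : τ ∈ randomizedStoppingTimes 𝓕) (ω : Ω)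
    (t : Set.Icc (0 : ℝ) T) : ContinuousWithinAt (stopCdf τ ω) (Set.Ici t) t := by
  rw [← Set.Ioi_insert, continuousWithinAt_insert_self]
  by_cases ht : t = ⊤
  · have : Set.Ioi t = ∅ := by simp [ht]
    rw [this, ContinuousWithinAt, nhdsWithin_empty]; exact tendsto_bot
  have h := tendsto_measure_biInter_gt (μ := (volume : Measure unitInterval))
    (s := fun r => {u | τ ω u ≤ r}) (a := t)
    (fun r _ => (measurable_section hτ ω measurableSet_Iic).nullMeasurableSet)
    (fun i j _ hij u hu => le_trans hu hij) ⟨⊤, lt_top_iff_ne_top.2 ht, measure_ne_top _ _⟩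
  have h2 : ⋂ r, ⋂ (_ : r > t), {u | τ ω u ≤ r} = {u | τ ω u ≤ t} := by
    ext u
    simp only [Set.mem_iInter, Set.mem_ofPred_eq]
    exact ⟨fun h => le_of_forall_gt_imp_ge_of_dense h, fun h r hr => h.trans hr.le⟩
  rw [h2] at h
  exact h

/-- Randomized stopping times can be mixed. -/
theorem exists_mixture (h₁ : τ₁ ∈ randomizedStoppingTimes 𝓕) (h₂ : τ₂ ∈ randomizedStoppingTimes 𝓕)
    {a b : ℝ≥0} (hab : a + b = 1) :
    ∃ τ ∈ randomizedStoppingTimes 𝓕,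
      ∀ ω, (volume : Measure unitInterval).map (τ ω) =
        a • (volume : Measure unitInterval).map (τ₁ ω) +
          b • (volume : Measure unitInterval).map (τ₂ ω) := by
  -- The distribution functions are averaged, not the times: this makes the law, hence the value,
  -- affine.
  let A : Ω → Set.Icc (0 : ℝ) T → ℝ≥0∞ := fun ω t => a * stopCdf τ₁ ω t + b * stopCdf τ₂ ω t
  have hmono : ∀ ω, Monotone (A ω) := fun ω s t hst => by
    have h₁ := monotone_stopCdf (τ := τ₁) ω hst
    have h₂ := monotone_stopCdf (τ := τ₂) ω hst
    simp only [A]; gcongr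
  have hr : ∀ ω t, ContinuousWithinAt (A ω) (Set.Ici t) t := fun ω t => by
    have c₁ := ENNReal.Tendsto.const_mul (a := (a : ℝ≥0∞)) (continuousWithinAt_stopCdf h₁ ω t)
      (Or.inr ENNReal.coe_ne_top)
    have c₂ := ENNReal.Tendsto.const_mul (a := (b : ℝ≥0∞)) (continuousWithinAt_stopCdf h₂ ω t)
      (Or.inr ENNReal.coe_ne_top)
    exact c₁.add c₂
  have htop : ∀ ω, A ω ⊤ = 1 := fun ω => by
    simp only [A, stopCdf_top, mul_one]
    exact_mod_cast hab
  have hmeas : ∀ t, Measurable[𝓕 t] fun ω => A ω t := fun t =>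
    ((measurable_stopCdf h₁ t).const_mul _).add ((measurable_stopCdf h₂ t).const_mul _)
  have hmem : (fun ω u => quantile (A ω) u) ∈ randomizedStoppingTimes 𝓕 := by
    refine ⟨fun ω => monotone_quantile,
      fun ω u => continuousWithinAt_quantile (hmono ω) (hr ω) (htop ω) u,
      fun u => mem_stoppingTimes_iff.2 fun t => ?_⟩
    simp only [quantile_le_iff (hmono _) (hr _) (htop _)]
    exact hmeas t measurableSet_Ici
  refine ⟨_, hmem, fun ω => ?_⟩
  have : IsFiniteMeasure ((volume : Measure unitInterval).map (quantile (A ω))) :=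
    Measure.isFiniteMeasure_map _ _
  refine Measure.ext_of_Iic _ _ fun t => ?_
  rw [Measure.map_apply (measurable_section hmem ω) measurableSet_Iic, Measure.add_apply,
    Measure.smul_apply, Measure.smul_apply,
    Measure.map_apply (measurable_section h₁ ω) measurableSet_Iic,
    Measure.map_apply (measurable_section h₂ ω) measurableSet_Iic]
  exact volume_setOf_quantile_le (hmono ω) (hr ω) (htop ω) t

end Law

/-! ### Limits of randomized stopping times -/

section Compactness

variable {Ω : Type*} {mΩ : MeasurableSpace Ω} {T : ℝ} [Fact (0 ≤ T)]
  {𝓕 : Filtration (Set.Icc (0 : ℝ) T) mΩ}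

/-- If the conditional distribution functions of randomized stopping times converge almost surely
on a dense set of times, the randomized stopping times converge to a randomized stopping time. -/
theorem exists_tendsto_of_tendsto_stopCdf [𝓕.IsRightContinuous] {μ : Measure Ω}
    {τ : ℕ → Ω → unitInterval → Set.Icc (0 : ℝ) T} (hτ : ∀ n, τ n ∈ randomizedStoppingTimes 𝓕)
    (hconv : ∀ᵐ ω ∂μ, ∀ k, ∃ l, Tendsto (fun n => stopCdf (τ n) ω
      (TopologicalSpace.denseSeq (Set.Icc (0 : ℝ) T) k)) atTop (𝓝 l)) :
    ∃ σ ∈ randomizedStoppingTimes 𝓕, ∀ᵐ ω ∂μ, ∀ᵐ u : unitInterval,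
      Tendsto (fun n => τ n ω u) atTop (𝓝 (σ ω u)) := by
  let q := TopologicalSpace.denseSeq (Set.Icc (0 : ℝ) T)
  have hq : ∀ {s t : Set.Icc (0 : ℝ) T}, s < t → ∃ k, s < q k ∧ q k < t := fun {s t} h => by
    obtain ⟨_, ⟨k, rfl⟩, hk⟩ := (TopologicalSpace.denseRange_denseSeq
      (Set.Icc (0 : ℝ) T)).exists_between h
    exact ⟨k, hk.1, hk.2⟩
  -- The limsup is defined for every `ω` and is `𝓕 (q k)`-measurable, so no exceptional set enters
  -- the definition of `σ`.
  let B : Ω → ℕ → ℝ≥0∞ := fun ω k => limsup (fun n => stopCdf (τ n) ω (q k)) atTop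
  have hBmono : ∀ ω {j k}, q j ≤ q k → B ω j ≤ B ω k := fun ω j k h =>
    limsup_le_limsup (Eventually.of_forall fun n => monotone_stopCdf ω h)
  have hBmeas : ∀ k, Measurable[𝓕 (q k)] fun ω => B ω k := fun k =>
    Measurable.limsup fun n => measurable_stopCdf (hτ n) (q k)
  let σ : Ω → unitInterval → Set.Icc (0 : ℝ) T := fun ω u =>
    ⨅ (k) (_ : ENNReal.ofReal u ≤ B ω k), q k
  have hσlt : ∀ ω u t, σ ω u < t ↔ ∃ k, ENNReal.ofReal u ≤ B ω k ∧ q k < t := fun ω u t => by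
    simp only [σ, iInf_lt_iff, exists_prop]
  have hσle : ∀ ω (u : unitInterval) k, ENNReal.ofReal u ≤ B ω k → σ ω u ≤ q k :=
    fun ω u k h => iInf₂_le k h
  have hleσ : ∀ ω (u : unitInterval) k, B ω k < ENNReal.ofReal u → q k ≤ σ ω u :=
    fun ω u k h => le_iInf₂ fun j hj => by
      by_contra! hlt
      exact (hj.trans (hBmono ω hlt.le)).not_gt h
  have hmono : ∀ ω, Monotone (σ ω) := fun ω u v huv =>
    le_iInf₂ fun k hk => hσle ω u k ((ENNReal.ofReal_le_ofReal huv).trans hk)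
  refine ⟨σ, ⟨hmono, fun ω u => tendsto_order.2 ⟨fun c hc => ?_, fun c hc => ?_⟩, fun u => ?_⟩, ?_⟩
  · obtain ⟨k, hk1, hk2⟩ := hq hc
    have h1 : B ω k < ENNReal.ofReal u := by
      by_contra! h
      exact (hσle ω u k h).not_gt hk2
    have h2 : ∀ᶠ v : unitInterval in 𝓝 u, B ω k < ENNReal.ofReal v :=
      ((ENNReal.continuous_ofReal.comp continuous_subtype_val).tendsto u).eventually
        (lt_mem_nhds h1)
    filter_upwards [h2.filter_mono nhdsWithin_le_nhds] with v hv
    exact hk1.trans_le (hleσ ω v k hv)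
  · filter_upwards [self_mem_nhdsWithin] with v hv
    exact (hmono ω hv).trans_lt hc
  · refine mem_stoppingTimes_of_lt fun t => ?_
    simp only [hσlt, Set.ofPred_exists]
    refine MeasurableSet.iUnion fun k => ?_
    by_cases hk : q k < t
    · simp only [hk, and_true]
      exact 𝓕.mono hk.le _ (hBmeas k measurableSet_Ici)
    · simp [hk]
  · filter_upwards [hconv] with ω hω
    have hlim : ∀ k, Tendsto (fun n => stopCdf (τ n) ω (q k)) atTop (𝓝 (B ω k)) := fun k => by
      obtain ⟨l, hl⟩ := hω k
      have : B ω k = l := hl.limsup_eq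
      rwa [this]
    -- Each level `B ω k` is hit by at most one `u`. Off these countably many `u`, and off `0`, all
    -- comparisons are strict and hold for large `n`.
    have hcount : (insert (0 : unitInterval)
        (⋃ k, {u : unitInterval | ENNReal.ofReal u = B ω k})).Countable := by
      refine (Set.countable_iUnion fun k => Set.Subsingleton.countable ?_).insert _
      intro u hu v hv
      have h := hu.trans hv.symm
      exact Subtype.ext ((ENNReal.ofReal_eq_ofReal_iff u.2.1 v.2.1).1 h)
    filter_upwards [hcount.ae_notMem volume] with u hu
    simp only [Set.mem_insert_iff, Set.mem_iUnion, Set.mem_ofPred_eq, not_or, not_exists] at hu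
    have hu0 : 0 < u := unitInterval.pos_iff_ne_zero.2 hu.1
    refine tendsto_order.2 ⟨fun c hc => ?_, fun c hc => ?_⟩
    · obtain ⟨k, hk1, hk2⟩ := hq hc
      have h1 : B ω k < ENNReal.ofReal u := by
        by_contra! h
        exact (hσle ω u k h).not_gt hk2
      filter_upwards [(hlim k).eventually (gt_mem_nhds h1)] with n hn
      refine hk1.trans ?_
      rw [← not_le, ← ofReal_le_stopCdf_iff (hτ n) ω _ hu0, not_le]
      exact hn
    · obtain ⟨k, hk1, hk2⟩ := (hσlt ω u c).1 hc
      filter_upwards [(hlim k).eventually (lt_mem_nhds (hk1.lt_of_ne (hu.2 k)))] with n hn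
      exact ((ofReal_le_stopCdf_iff (hτ n) ω _ hu0).1 hn.le).trans_lt hk2

end Compactness

/-! ### The conjugate function and its coercivity -/

section Fenchel

variable {Φ : ℝ≥0 → ℝ≥0∞}

theorem IsDivergenceFunction.mul_sub_le_fenchelConjReal (hΦ : IsDivergenceFunction Φ) {x : ℝ≥0}
    (hx : Φ x ≠ ∞) (y : ℝ) : (x : ℝ) * y - (Φ x).toReal ≤ fenchelConjReal Φ y := by
  rw [← EReal.coe_le_coe_iff, hΦ.coe_fenchelConjReal]
  refine le_trans (le_of_eq ?_) (le_iSup (fun x : ℝ≥0 => (((x : ℝ) * y : ℝ) : EReal) -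
    ((Φ x : ℝ≥0∞) : EReal)) x)
  lift Φ x to ℝ≥0 using hx with a
  rfl

theorem IsDivergenceFunction.fenchelConjReal_le (hΦ : IsDivergenceFunction Φ) {y c : ℝ}
    (h : ∀ x : ℝ≥0, Φ x ≠ ∞ → (x : ℝ) * y - (Φ x).toReal ≤ c) : fenchelConjReal Φ y ≤ c := by
  rw [← EReal.coe_le_coe_iff, hΦ.coe_fenchelConjReal]
  refine iSup_le fun x => ?_
  by_cases hx : Φ x = ∞
  · simp [hx]
  · have := h x hx
    lift Φ x to ℝ≥0 using hx with a
    exact EReal.coe_le_coe_iff.2 this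

theorem IsDivergenceFunction.monotone_fenchelConjReal (hΦ : IsDivergenceFunction Φ) :
    Monotone (fenchelConjReal Φ) := fun _ z hyz =>
  hΦ.fenchelConjReal_le fun x hx =>
    (sub_le_sub_right (mul_le_mul_of_nonneg_left hyz x.2) _).trans
      (hΦ.mul_sub_le_fenchelConjReal hx z)

theorem IsDivergenceFunction.convexOn_fenchelConjReal (hΦ : IsDivergenceFunction Φ) :
    ConvexOn ℝ Set.univ (fenchelConjReal Φ) := by
  refine ⟨convex_univ, fun y _ z _ a b ha hb hab => hΦ.fenchelConjReal_le fun x hx => ?_⟩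
  have h1 := mul_le_mul_of_nonneg_left (hΦ.mul_sub_le_fenchelConjReal hx y) ha
  have h2 := mul_le_mul_of_nonneg_left (hΦ.mul_sub_le_fenchelConjReal hx z) hb
  simp only [smul_eq_mul]
  have h3 : (x : ℝ) * (a * y + b * z) - (Φ x).toReal =
      a * ((x : ℝ) * y - (Φ x).toReal) + b * ((x : ℝ) * z - (Φ x).toReal) := by
    linear_combination (Φ x).toReal * hab
  linarith

theorem IsDivergenceFunction.continuous_fenchelConjReal (hΦ : IsDivergenceFunction Φ) :
    Continuous (fenchelConjReal Φ) :=
  continuousOn_univ.1 (hΦ.convexOn_fenchelConjReal.continuousOn isOpen_univ)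

/-- `Φ*(y) - y` grows linearly in both directions. -/
theorem IsDivergenceFunction.exists_affine_le (hΦ : IsDivergenceFunction Φ) :
    ∃ δ > 0, ∃ C : ℝ, ∀ x y : ℝ, 0 ≤ y → δ * |x| - C ≤ fenchelConjReal Φ (x + y) - x := by
  have h := mem_interior_iff_mem_nhds.1 hΦ.one_mem_interior_dom
  obtain ⟨l, u, ⟨hl, hu⟩, hsub⟩ := (mem_nhds_iff_exists_Ioo_subset' (a := (1 : ℝ≥0))
    ⟨0, zero_lt_one⟩ ⟨2, one_lt_two⟩).1 h
  obtain ⟨a, hla, ha⟩ := exists_between hl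
  obtain ⟨b, hb, hbu⟩ := exists_between hu
  have hΦa : Φ a ≠ ∞ := (hsub ⟨hla, ha.trans hu⟩ : Φ a < ∞).ne
  have hΦb : Φ b ≠ ∞ := (hsub ⟨hl.trans hb, hbu⟩ : Φ b < ∞).ne
  have ha' : (a : ℝ) < 1 := by exact_mod_cast ha
  have hb' : (1 : ℝ) < b := by exact_mod_cast hb
  -- The affine minorants of `Φ*` with slopes `a < 1 < b` become slopes `a - 1 < 0 < b - 1` after
  -- subtracting `x`; the terms in `y ≥ 0` only help.
  refine ⟨min (1 - a) (b - 1), lt_min (by linarith) (by linarith),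
    max (Φ a).toReal (Φ b).toReal, fun x y hy => ?_⟩
  have h1 := hΦ.mul_sub_le_fenchelConjReal hΦa (x + y)
  have h2 := hΦ.mul_sub_le_fenchelConjReal hΦb (x + y)
  have h3 : 0 ≤ (a : ℝ) * y := mul_nonneg a.2 hy
  have h4 : 0 ≤ (b : ℝ) * y := mul_nonneg b.2 hy
  have h5 := le_max_left (Φ a).toReal (Φ b).toReal
  have h6 := le_max_right (Φ a).toReal (Φ b).toReal
  rcases abs_cases x with ⟨hx, hx0⟩ | ⟨hx, hx0⟩
  · have h7 := mul_le_mul_of_nonneg_right (min_le_right (1 - (a : ℝ)) (b - 1)) hx0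
    rw [hx]
    nlinarith
  · have h7 := mul_le_mul_of_nonneg_right (min_le_left (1 - (a : ℝ)) (b - 1)) (abs_nonneg x)
    rw [hx] at h7 ⊢
    nlinarith

end Fenchel

/-! ### Integrability, convexity and continuity of the value -/

section Payoff

variable {Ω : Type*} {mΩ : MeasurableSpace Ω} {T : ℝ} {𝓕 : Filtration (Set.Icc (0 : ℝ) T) mΩ}

theorem measurable_uncurry_of_mem_randomizedStoppingTimes
    {τ : Ω → unitInterval → Set.Icc (0 : ℝ) T} (hτ : τ ∈ randomizedStoppingTimes 𝓕) :
    Measurable fun p : Ω × unitInterval => τ p.1 p.2 := by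
  refine measurable_of_Ioi fun t => ?_
  let v := TopologicalSpace.denseSeq unitInterval
  -- By left-continuity `τ ω u > t` already holds at some dense level below `u`; only `u = 0` needs
  -- its own term.
  have heq : (fun p : Ω × unitInterval => τ p.1 p.2) ⁻¹' Set.Ioi t =
      ({ω | t < τ ω 0} ×ˢ Set.univ) ∪ ⋃ k, {ω | t < τ ω (v k)} ×ˢ Set.Ici (v k) := by
    ext ⟨ω, u⟩
    simp only [Set.mem_preimage, Set.mem_Ioi, Set.mem_union, Set.mem_prod, Set.mem_ofPred_eq,
      Set.mem_univ, and_true, Set.mem_iUnion, Set.mem_Ici]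
    constructor
    · intro h
      rcases eq_or_ne u 0 with rfl | hu
      · exact Or.inl h
      have h1 : ∀ᶠ w in 𝓝[≤] u, t < τ ω w := (hτ.2.1 ω u).eventually (lt_mem_nhds h)
      obtain ⟨w, hw, hsub⟩ :=
        (mem_nhdsLE_iff_exists_Ioc_subset' (unitInterval.pos_iff_ne_zero.2 hu)).1 h1
      obtain ⟨_, ⟨k, rfl⟩, hk⟩ := (TopologicalSpace.denseRange_denseSeq
        unitInterval).exists_between (Set.mem_Iio.1 hw)
      exact Or.inr ⟨k, hsub ⟨hk.1, hk.2.le⟩, hk.2.le⟩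
    · rintro (h | ⟨k, h, hk⟩)
      · exact h.trans_le (hτ.1 ω unitInterval.nonneg')
      · exact h.trans_le (hτ.1 ω hk)
  have hm : ∀ u, MeasurableSet {ω | t < τ ω u} := fun u =>
    measurable_of_mem_stoppingTimes (hτ.2.2 u) measurableSet_Ioi
  rw [heq]
  exact ((hm 0).prod MeasurableSet.univ).union
    (MeasurableSet.iUnion fun k => (hm _).prod measurableSet_Ici)

/-- The standing conditions on the process: joint measurability, nonnegativity, and a supremum in
the Orlicz heart. -/
structure IsOrliczProcess (Φ : ℝ≥0 → ℝ≥0∞) (Y : Set.Icc (0 : ℝ) T → Ω → ℝ) (μ : Measure Ω) :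
    Prop where
  measurable : Measurable fun p : Set.Icc (0 : ℝ) T × Ω => Y p.1 p.2
  nonneg : ∀ t ω, 0 ≤ Y t ω
  bddAbove : ∀ᵐ ω ∂μ, BddAbove (Set.range fun t => Y t ω)
  memOrliczHeart : MemOrliczHeart (youngConj Φ) (fun ω => ⨆ t, Y t ω) μ

/-- An integrable bound for `Φ*(x + Y_t) - x`, uniform in `t`. -/
noncomputable def payoffBound (Φ : ℝ≥0 → ℝ≥0∞) (Y : Set.Icc (0 : ℝ) T → Ω → ℝ) (x : ℝ) (ω : Ω) : ℝ :=
  |fenchelConjReal Φ x| + |fenchelConjReal Φ (2 * |x|)| + |x| +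
    max (fenchelConjReal Φ (2 * ⨆ t, Y t ω)) 0

variable {Φ : ℝ≥0 → ℝ≥0∞} {Y : Set.Icc (0 : ℝ) T → Ω → ℝ} {μ : Measure Ω}
  {τ τ₁ τ₂ : Ω → unitInterval → Set.Icc (0 : ℝ) T}

theorem IsOrliczProcess.integrable_payoffBound [IsFiniteMeasure μ] (h : IsOrliczProcess Φ Y μ)
    (hΦ : IsDivergenceFunction Φ) (x : ℝ) : Integrable (payoffBound Φ Y x) μ := by
  refine (integrable_const _).add ⟨?_, ?_⟩
  · exact ((hΦ.continuous_fenchelConjReal.measurable.comp_aemeasurable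
      (h.memOrliczHeart.1.const_mul 2)).max aemeasurable_const).aestronglyMeasurable
  · refine lt_of_le_of_lt (lintegral_mono fun ω => ?_) (h.memOrliczHeart.2 2 two_pos)
    have h1 : 0 ≤ ⨆ t, Y t ω := Real.iSup_nonneg fun t => h.nonneg t ω
    have h2 : ((2 * ‖⨆ t, Y t ω‖₊ : ℝ≥0) : ℝ) = 2 * ⨆ t, Y t ω := by
      simp [abs_of_nonneg h1]
    rw [youngConj, h2, ← hΦ.coe_fenchelConjReal, EReal.toENNReal_of_ne_top (EReal.coe_ne_top _),
      EReal.toReal_coe, Real.enorm_eq_ofReal (le_max_right _ _), ENNReal.ofReal_max]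
    simp

theorem IsOrliczProcess.ae_abs_le_payoffBound (h : IsOrliczProcess Φ Y μ)
    (hΦ : IsDivergenceFunction Φ) (x : ℝ) :
    ∀ᵐ ω ∂μ, ∀ t, |fenchelConjReal Φ (x + Y t ω) - x| ≤ payoffBound Φ Y x ω := by
  filter_upwards [h.bddAbove] with ω hω t
  have h1 : Y t ω ≤ ⨆ t, Y t ω := le_ciSup hω t
  have h2 : fenchelConjReal Φ x ≤ fenchelConjReal Φ (x + Y t ω) :=
    hΦ.monotone_fenchelConjReal (by linarith [h.nonneg t ω])
  -- Writing `|x| + sup Y` as the midpoint of `2|x|` and `2 sup Y` lets convexity separate them;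
  -- hence the factors `2` in the bound.
  have h3 : fenchelConjReal Φ (x + Y t ω) ≤
      fenchelConjReal Φ ((1 / 2 : ℝ) • (2 * |x|) + (1 / 2 : ℝ) • (2 * ⨆ t, Y t ω)) :=
    hΦ.monotone_fenchelConjReal (by
      simp only [smul_eq_mul]
      linarith [le_abs_self x])
  have h4 := h3.trans (hΦ.convexOn_fenchelConjReal.2 (Set.mem_univ _) (Set.mem_univ _)
    (by norm_num) (by norm_num) (by norm_num))
  simp only [smul_eq_mul] at h4
  have h5 := le_max_left (fenchelConjReal Φ (2 * ⨆ t, Y t ω)) 0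
  have h6 := le_max_right (fenchelConjReal Φ (2 * ⨆ t, Y t ω)) 0
  have h7 := le_abs_self (fenchelConjReal Φ (2 * |x|))
  have h8 := neg_abs_le (fenchelConjReal Φ x)
  have h9 := le_abs_self x
  have h10 := neg_abs_le x
  have h11 := abs_nonneg (fenchelConjReal Φ (2 * |x|))
  have h12 := abs_nonneg (fenchelConjReal Φ x)
  rw [payoffBound, abs_le]
  constructor <;> linarith

theorem IsOrliczProcess.measurable_payoff (h : IsOrliczProcess Φ Y μ)
    (hΦ : IsDivergenceFunction Φ) (x : ℝ) :
    Measurable fun p : Set.Icc (0 : ℝ) T × Ω => fenchelConjReal Φ (x + Y p.1 p.2) - x :=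
  (hΦ.continuous_fenchelConjReal.measurable.comp (h.measurable.const_add x)).sub_const x

theorem IsOrliczProcess.measurable_randomizedPayoff (h : IsOrliczProcess Φ Y μ)
    (hΦ : IsDivergenceFunction Φ) (hτ : τ ∈ randomizedStoppingTimes 𝓕) (x : ℝ) :
    Measurable (randomizedPayoff Φ Y τ x) := by
  have h1 : Measurable fun p : Ω × unitInterval => (τ p.1 p.2, p.1) :=
    (measurable_uncurry_of_mem_randomizedStoppingTimes hτ).prodMk measurable_fst
  have h2 : Measurable ((fun p : Set.Icc (0 : ℝ) T × Ω => fenchelConjReal Φ (x + Y p.1 p.2) - x) ∘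
    fun p : Ω × unitInterval => (τ p.1 p.2, p.1)) := (h.measurable_payoff hΦ x).comp h1
  exact h2

theorem IsOrliczProcess.ae_abs_randomizedPayoff_le [IsFiniteMeasure μ] (h : IsOrliczProcess Φ Y μ)
    (hΦ : IsDivergenceFunction Φ) (τ : Ω → unitInterval → Set.Icc (0 : ℝ) T) (x : ℝ) :
    ∀ᵐ p ∂μ.prod (volume : Measure unitInterval),
      |randomizedPayoff Φ Y τ x p| ≤ payoffBound Φ Y x p.1 := by
  have := (Measure.quasiMeasurePreserving_fst (μ := μ)
    (ν := (volume : Measure unitInterval))).ae (h.ae_abs_le_payoffBound hΦ x)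
  filter_upwards [this] with p hp
  exact hp _

theorem IsOrliczProcess.integrable_randomizedPayoff [IsFiniteMeasure μ] (h : IsOrliczProcess Φ Y μ)
    (hΦ : IsDivergenceFunction Φ) (hτ : τ ∈ randomizedStoppingTimes 𝓕) (x : ℝ) :
    Integrable (randomizedPayoff Φ Y τ x) (μ.prod (volume : Measure unitInterval)) :=
  ((h.integrable_payoffBound hΦ x).comp_fst volume).mono'
    (h.measurable_randomizedPayoff hΦ hτ x).aestronglyMeasurable
    (h.ae_abs_randomizedPayoff_le hΦ τ x)

theorem IsOrliczProcess.convexOn_randomizedValue [IsFiniteMeasure μ] (h : IsOrliczProcess Φ Y μ)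
    (hΦ : IsDivergenceFunction Φ) (hτ : τ ∈ randomizedStoppingTimes 𝓕) :
    ConvexOn ℝ Set.univ (randomizedValue Φ Y μ τ) := by
  refine ⟨convex_univ, fun x _ y _ a b ha hb hab => ?_⟩
  have hx := h.integrable_randomizedPayoff hΦ hτ x
  have hy := h.integrable_randomizedPayoff hΦ hτ y
  simp only [randomizedValue, smul_eq_mul]
  rw [← integral_const_mul, ← integral_const_mul,
    ← integral_add (hx.const_mul a) (hy.const_mul b)]
  refine integral_mono (h.integrable_randomizedPayoff hΦ hτ _)
    ((hx.const_mul a).add (hy.const_mul b)) fun p => ?_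
  have h1 := hΦ.convexOn_fenchelConjReal.2 (Set.mem_univ (x + Y (τ p.1 p.2) p.1))
    (Set.mem_univ (y + Y (τ p.1 p.2) p.1)) ha hb hab
  have h2 : a • (x + Y (τ p.1 p.2) p.1) + b • (y + Y (τ p.1 p.2) p.1) =
      a * x + b * y + Y (τ p.1 p.2) p.1 := by
    simp only [smul_eq_mul]
    linear_combination Y (τ p.1 p.2) p.1 * hab
  rw [h2] at h1
  simp only [randomizedPayoff, smul_eq_mul] at h1 ⊢
  linarith

theorem IsOrliczProcess.randomizedValue_le [IsProbabilityMeasure μ] (h : IsOrliczProcess Φ Y μ)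
    (hΦ : IsDivergenceFunction Φ) (hτ : τ ∈ randomizedStoppingTimes 𝓕) (x : ℝ) :
    randomizedValue Φ Y μ τ x ≤ ∫ ω, payoffBound Φ Y x ω ∂μ := by
  have h1 : ∫ p, payoffBound Φ Y x p.1 ∂μ.prod (volume : Measure unitInterval) =
      ∫ ω, payoffBound Φ Y x ω ∂μ := by
    rw [integral_fun_fst]; simp
  rw [← h1]
  refine integral_mono_ae (h.integrable_randomizedPayoff hΦ hτ x)
    ((h.integrable_payoffBound hΦ x).comp_fst volume) ?_
  filter_upwards [h.ae_abs_randomizedPayoff_le hΦ τ x] with p hp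
  exact (le_abs_self _).trans hp

theorem IsOrliczProcess.exists_affine_le_randomizedValue [IsProbabilityMeasure μ]
    (h : IsOrliczProcess Φ Y μ) (hΦ : IsDivergenceFunction Φ) :
    ∃ δ > 0, ∃ C : ℝ, ∀ τ ∈ randomizedStoppingTimes 𝓕, ∀ x : ℝ,
      δ * |x| - C ≤ randomizedValue Φ Y μ τ x := by
  obtain ⟨δ, hδ, C, hC⟩ := hΦ.exists_affine_le
  refine ⟨δ, hδ, C, fun τ hτ x => ?_⟩
  calc δ * |x| - C = ∫ _, (δ * |x| - C) ∂μ.prod (volume : Measure unitInterval) := by simp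
    _ ≤ _ := integral_mono (integrable_const _) (h.integrable_randomizedPayoff hΦ hτ x)
      fun p => hC x _ (h.nonneg _ _)

/-- Exhibits the value as a function of the conditional laws alone, linear in them. -/
theorem IsOrliczProcess.randomizedValue_eq_integral_map [IsFiniteMeasure μ]
    (h : IsOrliczProcess Φ Y μ) (hΦ : IsDivergenceFunction Φ)
    (hτ : τ ∈ randomizedStoppingTimes 𝓕) (x : ℝ) :
    randomizedValue Φ Y μ τ x = ∫ ω, ∫ t, fenchelConjReal Φ (x + Y t ω) - x
      ∂(volume : Measure unitInterval).map (τ ω) ∂μ := by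
  rw [randomizedValue, integral_prod _ (h.integrable_randomizedPayoff hΦ hτ x)]
  refine integral_congr_ae (Eventually.of_forall fun ω => ?_)
  have hm := (h.measurable_payoff hΦ x).comp (measurable_prodMk_right (y := ω))
  exact (integral_map (measurable_section hτ ω).aemeasurable hm.aestronglyMeasurable).symm

/-- The value is linear under mixtures of randomized stopping times. -/
theorem IsOrliczProcess.randomizedValue_of_map_eq [IsFiniteMeasure μ] (h : IsOrliczProcess Φ Y μ)
    (hΦ : IsDivergenceFunction Φ) (hτ : τ ∈ randomizedStoppingTimes 𝓕)
    (h₁ : τ₁ ∈ randomizedStoppingTimes 𝓕) (h₂ : τ₂ ∈ randomizedStoppingTimes 𝓕) {a b : ℝ≥0}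
    (hlaw : ∀ ω, (volume : Measure unitInterval).map (τ ω) =
      a • (volume : Measure unitInterval).map (τ₁ ω) +
        b • (volume : Measure unitInterval).map (τ₂ ω)) (x : ℝ) :
    randomizedValue Φ Y μ τ x = a * randomizedValue Φ Y μ τ₁ x + b * randomizedValue Φ Y μ τ₂ x := by
  have hint : ∀ {σ : Ω → unitInterval → Set.Icc (0 : ℝ) T}, σ ∈ randomizedStoppingTimes 𝓕 →
      Integrable (fun ω => ∫ t, fenchelConjReal Φ (x + Y t ω) - x
        ∂(volume : Measure unitInterval).map (σ ω)) μ := fun {σ} hσ => by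
    refine (h.integrable_randomizedPayoff hΦ hσ x).integral_prod_left.congr
      (Eventually.of_forall fun ω => ?_)
    have hm := (h.measurable_payoff hΦ x).comp (measurable_prodMk_right (y := ω))
    exact (integral_map (measurable_section hσ ω).aemeasurable hm.aestronglyMeasurable).symm
  rw [h.randomizedValue_eq_integral_map hΦ hτ, h.randomizedValue_eq_integral_map hΦ h₁,
    h.randomizedValue_eq_integral_map hΦ h₂, ← integral_const_mul, ← integral_const_mul,
    ← integral_add ((hint h₁).const_mul _) ((hint h₂).const_mul _)]
  refine integral_congr_ae ?_
  filter_upwards [h.ae_abs_le_payoffBound hΦ x] with ω hω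
  have hm := (h.measurable_payoff hΦ x).comp (measurable_prodMk_right (y := ω))
  have hi : ∀ (ν : Measure (Set.Icc (0 : ℝ) T)) [IsFiniteMeasure ν],
      Integrable (fun t => fenchelConjReal Φ (x + Y t ω) - x) ν := fun ν _ =>
    Integrable.of_bound hm.aestronglyMeasurable _ (Eventually.of_forall hω)
  simp only [hlaw]
  rw [integral_add_measure (hi _) (hi _), integral_smul_nnreal_measure,
    integral_smul_nnreal_measure]
  rfl

theorem IsOrliczProcess.tendsto_randomizedValue [IsFiniteMeasure μ] (h : IsOrliczProcess Φ Y μ)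
    (hΦ : IsDivergenceFunction Φ) {τs : ℕ → Ω → unitInterval → Set.Icc (0 : ℝ) T}
    (hτs : ∀ n, τs n ∈ randomizedStoppingTimes 𝓕)
    (hlim : ∀ᵐ p ∂μ.prod (volume : Measure unitInterval),
      Tendsto (fun n => Y (τs n p.1 p.2) p.1) atTop (𝓝 (Y (τ p.1 p.2) p.1))) (x : ℝ) :
    Tendsto (fun n => randomizedValue Φ Y μ (τs n) x) atTop (𝓝 (randomizedValue Φ Y μ τ x)) := by
  refine tendsto_integral_of_dominated_convergence (fun p => payoffBound Φ Y x p.1)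
    (fun n => (h.measurable_randomizedPayoff hΦ (hτs n) x).aestronglyMeasurable)
    ((h.integrable_payoffBound hΦ x).comp_fst volume)
    (fun n => h.ae_abs_randomizedPayoff_le hΦ (τs n) x) ?_
  filter_upwards [hlim] with p hp
  exact ((hΦ.continuous_fenchelConjReal.tendsto _).comp (hp.const_add x)).sub_const x

end Payoff

/-! ### Minimax for coercive convex functions on the line -/

section Minimax

variable {K : Set (ℝ → ℝ)} {C M : ℝ}

theorem iInf_Icc_eq_iInf_of_le {h : ℝ → EReal} {c : EReal} (hM : 0 ≤ M) (h0 : h 0 ≤ c)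
    (hc : ∀ x, M < |x| → c ≤ h x) : ⨅ x ∈ Set.Icc (-M) M, h x = ⨅ x, h x := by
  refine le_antisymm (le_iInf fun x => ?_) (le_iInf₂ fun x _ => iInf_le _ x)
  rcases le_or_gt |x| M with hx | hx
  · exact iInf₂_le x (abs_le.1 hx)
  · exact (iInf₂_le 0 ⟨by linarith, hM⟩).trans (h0.trans (hc x hx))

/-- A minimax theorem on the real line for a convex family of uniformly coercive convex
functions. -/
theorem iSup_iInf_eq_iInf_iSup_of_convex (hne : K.Nonempty) (hK : Convex ℝ K)
    (hconv : ∀ g ∈ K, ConvexOn ℝ Set.univ g) (hM : 0 ≤ M) (h0 : ∀ g ∈ K, g 0 ≤ C)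
    (hC : ∀ g ∈ K, ∀ x, M < |x| → C ≤ g x) :
    ⨆ g ∈ K, ⨅ x : ℝ, (g x : EReal) = ⨅ x : ℝ, ⨆ g ∈ K, (g x : EReal) := by
  have hX : (Set.Icc (-M) M).Nonempty := ⟨0, by linarith, hM⟩
  -- The compact variable is `x`. The family `K` carries the pointwise topology, in which evaluation
  -- at `x` is continuous and linear.
  have key := Sion.minimax' (X := Set.Icc (-M) M) (Y := K)
    (f := fun (x : ℝ) (g : ℝ → ℝ) => (g x : EReal)) hX (convex_Icc _ _) isCompact_Icc
    (fun g hg => (continuous_coe_real_ereal.comp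
      (continuousOn_univ.1 ((hconv g hg).continuousOn isOpen_univ))).continuousOn.lowerSemicontinuousOn)
    (fun g hg => QuasiconvexOn.monotone_comp (g := Real.toEReal) EReal.coe_strictMono.monotone
      ((hconv g hg).subset (Set.subset_univ _) (convex_Icc _ _)).quasiconvexOn)
    hK
    (fun x _ => (continuous_coe_real_ereal.comp (continuous_apply x)).continuousOn.upperSemicontinuousOn)
    (fun x _ => by
      have h1 : ConcaveOn ℝ K fun g : ℝ → ℝ => g x :=
        (LinearMap.concaveOn (LinearMap.proj x : (ℝ → ℝ) →ₗ[ℝ] ℝ) hK)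
      exact QuasiconcaveOn.monotone_comp (g := Real.toEReal) EReal.coe_strictMono.monotone
        h1.quasiconcaveOn)
  rw [← iInf_Icc_eq_iInf_of_le (c := (C : EReal)) hM
    (iSup₂_le fun g hg => EReal.coe_le_coe_iff.2 (h0 g hg)) fun x hx => ?_, key]
  · refine biSup_congr fun g hg => (iInf_Icc_eq_iInf_of_le (c := (C : EReal)) hM ?_ ?_).symm
    · exact EReal.coe_le_coe_iff.2 (h0 g hg)
    · exact fun x hx => EReal.coe_le_coe_iff.2 (hC g hg x hx)
  · obtain ⟨g, hg⟩ := hne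
    exact (EReal.coe_le_coe_iff.2 (hC g hg x hx)).trans
      (le_iSup₂ (f := fun (g : ℝ → ℝ) (_ : g ∈ K) => (g x : EReal)) g hg)

/-- Only the side of `x` is compact, so the minimum over `x` is attained while `K` offers merely
`ε`-optimal elements. The bound `hbdd` keeps the minimax value finite. -/
theorem exists_minimizer_of_convex (hne : K.Nonempty) (hK : Convex ℝ K)
    (hconv : ∀ g ∈ K, ConvexOn ℝ Set.univ g) (hM : 0 ≤ M) (h0 : ∀ g ∈ K, g 0 ≤ C)
    (hC : ∀ g ∈ K, ∀ x, M < |x| → C ≤ g x) (hbdd : ∀ x, ∃ c, ∀ g ∈ K, g x ≤ c) :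
    ∃ x₀ V : ℝ, (∀ g ∈ K, g x₀ ≤ V) ∧ ∀ ε > 0, ∃ g ∈ K, ∀ x, V - ε ≤ g x := by
  have key := iSup_iInf_eq_iInf_iSup_of_convex hne hK hconv hM h0 hC
  let h : ℝ → EReal := fun x => ⨆ g ∈ K, (g x : EReal)
  have hlsc : LowerSemicontinuous h := lowerSemicontinuous_biSup fun g hg =>
    (continuous_coe_real_ereal.comp
      (continuousOn_univ.1 ((hconv g hg).continuousOn isOpen_univ))).lowerSemicontinuous
  obtain ⟨x₀, hx₀, hmin⟩ := LowerSemicontinuousOn.exists_isMinOn (s := Set.Icc (-M) M)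
    ⟨0, by linarith, hM⟩ isCompact_Icc (hlsc.lowerSemicontinuousOn _)
  have hle : ∀ {g}, g ∈ K → ∀ x, (g x : EReal) ≤ h x := fun {g} hg x =>
    le_iSup₂ (f := fun (g : ℝ → ℝ) (_ : g ∈ K) => (g x : EReal)) g hg
  obtain ⟨g₀, hg₀⟩ := hne
  obtain ⟨c, hc⟩ := hbdd x₀
  have hbot : h x₀ ≠ ⊥ := ne_bot_of_le_ne_bot (EReal.coe_ne_bot _) (hle hg₀ x₀)
  have htop : h x₀ ≠ ⊤ := ne_top_of_le_ne_top (EReal.coe_ne_top c)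
    (iSup₂_le fun g hg => EReal.coe_le_coe_iff.2 (hc g hg))
  have hinf : ⨅ x, h x = h x₀ := by
    rw [← iInf_Icc_eq_iInf_of_le (c := (C : EReal)) hM
      (iSup₂_le fun g hg => EReal.coe_le_coe_iff.2 (h0 g hg))
      fun x hx => (EReal.coe_le_coe_iff.2 (hC g₀ hg₀ x hx)).trans (hle hg₀ x)]
    exact le_antisymm (iInf₂_le x₀ hx₀) (le_iInf₂ hmin)
  refine ⟨x₀, (h x₀).toReal, fun g hg => ?_, fun ε hε => ?_⟩
  · rw [← EReal.coe_le_coe_iff, EReal.coe_toReal htop hbot]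
    exact hle hg x₀
  · have h1 : (((h x₀).toReal - ε : ℝ) : EReal) < ⨆ g ∈ K, ⨅ x : ℝ, (g x : EReal) := by
      rw [key]
      change _ < ⨅ x, h x
      rw [hinf, ← EReal.coe_toReal htop hbot, EReal.coe_lt_coe_iff, EReal.toReal_coe]
      linarith
    obtain ⟨g, hg⟩ := lt_iSup_iff.1 h1
    obtain ⟨hgK, hg⟩ := lt_iSup_iff.1 hg
    exact ⟨g, hgK, fun x => EReal.coe_le_coe_iff.1 (hg.le.trans (iInf_le _ x))⟩

end Minimax

/-! ### Almost everywhere convergence from near-minimal norms -/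

section Selection

/-- From a decreasing sequence of midpoint-convex families of functions with values in `[0,1]` one
can select an almost everywhere convergent sequence. -/
theorem exists_ae_tendsto_of_midpoint {X : Type*} [MeasurableSpace X] {P : Measure X}
    [IsFiniteMeasure P] {S : ℕ → Set (X → ℝ)} (hanti : Antitone S) (hne : ∀ n, (S n).Nonempty)
    (hmeas : ∀ n, ∀ f ∈ S n, Measurable f) (h01 : ∀ n, ∀ f ∈ S n, ∀ x, |f x| ≤ 1)
    (hmid : ∀ n, ∀ f ∈ S n, ∀ g ∈ S n, (fun x => (f x + g x) / 2) ∈ S n) :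
    ∃ f : ℕ → X → ℝ, (∀ n, f n ∈ S n) ∧
      ∀ᵐ x ∂P, ∃ l, Tendsto (fun n => f n x) atTop (𝓝 l) := by
  let N : (X → ℝ) → ℝ := fun f => ∫ x, f x ^ 2 ∂P
  have hN0 : ∀ f, 0 ≤ N f := fun f => integral_nonneg fun x => sq_nonneg _
  have hint : ∀ {f : X → ℝ}, Measurable f → ∀ {c : ℝ}, (∀ x, |f x| ≤ c) →
      Integrable (fun x => f x ^ 2) P := fun {f} hf {c} hc =>
    Integrable.of_bound (hf.pow_const 2).aestronglyMeasurable (c ^ 2)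
      (Eventually.of_forall fun x => by
        rw [norm_pow, Real.norm_eq_abs]
        exact pow_le_pow_left₀ (abs_nonneg _) (hc x) 2)
  have hint1 : ∀ n, ∀ f ∈ S n, Integrable (fun x => f x ^ 2) P := fun n f hf =>
    hint (hmeas n f hf) (h01 n f hf)
  let a : ℕ → ℝ := fun n => sInf (N '' S n)
  have hbdd : ∀ n, BddBelow (N '' S n) := fun n => ⟨0, by rintro _ ⟨f, _, rfl⟩; exact hN0 f⟩
  have ha_le : ∀ n, ∀ f ∈ S n, a n ≤ N f := fun n f hf => csInf_le (hbdd n) ⟨f, hf, rfl⟩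
  have ha_mono : Monotone a := fun m n hmn =>
    csInf_le_csInf (hbdd m) ((hne n).image N) (Set.image_mono (hanti hmn))
  have ha_bdd : BddAbove (Set.range a) := by
    refine ⟨P.real Set.univ, ?_⟩
    rintro _ ⟨n, rfl⟩
    obtain ⟨f, hf⟩ := hne n
    refine (ha_le n f hf).trans ?_
    calc N f ≤ ∫ _, (1 : ℝ) ∂P := integral_mono (hint1 n f hf) (integrable_const _) fun x =>
          (sq_le_one_iff_abs_le_one _).2 (h01 n f hf x)
      _ = P.real Set.univ := by simp
  have ha_lim := tendsto_atTop_ciSup ha_mono ha_bdd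
  have hle_sup : ∀ n, a n ≤ ⨆ n, a n := le_ciSup ha_bdd
  -- The minimal squared norms `a n` increase to a finite limit; the rate `4⁻ⁿ` will make L²
  -- distances of order `2⁻ⁿ`, hence summable.
  obtain ⟨φ, hφ, hφa⟩ := extraction_forall_of_eventually
    (P := fun n k => (⨆ n, a n) - a k < (1 / 4 : ℝ) ^ n) fun n => by
      have h1 : (⨆ n, a n) - (1 / 4 : ℝ) ^ n < ⨆ n, a n := by
        have : 0 < (1 / 4 : ℝ) ^ n := by positivity
        linarith
      filter_upwards [ha_lim.eventually (lt_mem_nhds h1)] with k hk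
      linarith
  have hsel : ∀ n, ∃ f ∈ S (φ n), N f < a (φ n) + (1 / 4 : ℝ) ^ n := fun n => by
    have h1 : a (φ n) < a (φ n) + (1 / 4 : ℝ) ^ n := by
      have : 0 < (1 / 4 : ℝ) ^ n := by positivity
      linarith
    obtain ⟨_, ⟨f, hf, rfl⟩, h2⟩ := exists_lt_of_csInf_lt ((hne (φ n)).image N) h1
    exact ⟨f, hf, h2⟩
  choose f hf hfN using hsel
  refine ⟨f, fun n => hanti (hφ.id_le n) (hf n), ?_⟩
  -- Parallelogram law: `N (f n)` and `N (f m)` are below `sup a + 4⁻ᵏ`, the midpoint's `N` is above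
  -- `sup a - 4⁻ᵏ`, and `2 + 2 + 4 = 8`.
  have hdiff : ∀ k n m, k ≤ n → k ≤ m → ∫ x, (f n x - f m x) ^ 2 ∂P ≤ 8 * (1 / 4 : ℝ) ^ k := by
    intro k n m hn hm
    have hfn : f n ∈ S (φ k) := hanti (hφ.monotone hn) (hf n)
    have hfm : f m ∈ S (φ k) := hanti (hφ.monotone hm) (hf m)
    have h1 : ∫ x, (f n x - f m x) ^ 2 ∂P =
        2 * N (f n) + 2 * N (f m) - 4 * N (fun x => (f n x + f m x) / 2) := by
      simp only [N]
      rw [← integral_const_mul, ← integral_const_mul, ← integral_const_mul, ← integral_add,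
        ← integral_sub]
      · exact integral_congr_ae (Eventually.of_forall fun x => by ring)
      · exact ((hint1 _ _ hfn).const_mul 2).add ((hint1 _ _ hfm).const_mul 2)
      · exact (hint1 _ _ (hmid _ _ hfn _ hfm)).const_mul 4
      · exact (hint1 _ _ hfn).const_mul 2
      · exact (hint1 _ _ hfm).const_mul 2
    have h2 := ha_le _ _ (hmid _ _ hfn _ hfm)
    have h3 := hfN n
    have h4 := hfN m
    have h5 := hφa k
    have h6 : (1 / 4 : ℝ) ^ n ≤ (1 / 4 : ℝ) ^ k :=
      pow_le_pow_of_le_one (by norm_num) (by norm_num) hn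
    have h7 : (1 / 4 : ℝ) ^ m ≤ (1 / 4 : ℝ) ^ k :=
      pow_le_pow_of_le_one (by norm_num) (by norm_num) hm
    linarith [hle_sup (φ n), hle_sup (φ m)]
  refine Lp.ae_tendsto_of_cauchy_eLpNorm (p := 2)
    (fun n => (hmeas _ _ (hf n)).aestronglyMeasurable) (by norm_num)
    -- The constant `3` exceeds `√8`, giving the strict bound required.
    (B := fun k => ENNReal.ofReal (3 * (1 / 2 : ℝ) ^ k)) ?_ fun k n m hn hm => ?_
  · rw [← ENNReal.ofReal_tsum_of_nonneg (fun k => by positivity)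
      ((summable_geometric_of_lt_one (by norm_num) (by norm_num)).mul_left 3)]
    exact ENNReal.ofReal_ne_top
  · have hL : MemLp (f n - f m) 2 P := by
      refine MemLp.of_bound ((hmeas _ _ (hf n)).sub (hmeas _ _ (hf m))).aestronglyMeasurable 2
        (Eventually.of_forall fun x => ?_)
      have h1 := abs_le.1 (h01 _ _ (hf n) x)
      have h2 := abs_le.1 (h01 _ _ (hf m) x)
      rw [Pi.sub_apply, Real.norm_eq_abs, abs_le]
      constructor <;> linarith
    rw [hL.eLpNorm_eq_integral_rpow_norm (by norm_num) (by norm_num)]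
    refine (ENNReal.ofReal_lt_ofReal_iff (by positivity)).2 ?_
    have h1 : ∫ x, ‖(f n - f m) x‖ ^ (2 : ℝ≥0∞).toReal ∂P = ∫ x, (f n x - f m x) ^ 2 ∂P := by
      refine integral_congr_ae (Eventually.of_forall fun x => ?_)
      simp
    rw [h1, ENNReal.toReal_ofNat, ← one_div, ← Real.sqrt_eq_rpow, Real.sqrt_lt' (by positivity)]
    refine (hdiff k n m hn hm).trans_lt ?_
    have h2 : (3 * (1 / 2 : ℝ) ^ k) ^ 2 = 9 * (1 / 4 : ℝ) ^ k := by
      rw [mul_pow, ← pow_mul, mul_comm k 2, pow_mul]; norm_num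
    rw [h2]
    have : 0 < (1 / 4 : ℝ) ^ k := by positivity
    linarith

end Selection

/-! ### Minimax identity and saddle point -/

section SaddlePoint

variable {Ω : Type*} {mΩ : MeasurableSpace Ω} {T : ℝ} {𝓕 : Filtration (Set.Icc (0 : ℝ) T) mΩ}
  {Φ : ℝ≥0 → ℝ≥0∞} {Y : Set.Icc (0 : ℝ) T → Ω → ℝ} {μ : Measure Ω}
  {τ τ₁ τ₂ : Ω → unitInterval → Set.Icc (0 : ℝ) T}

theorem const_mem_randomizedStoppingTimes (t : Set.Icc (0 : ℝ) T) :
    (fun (_ : Ω) (_ : unitInterval) => t) ∈ randomizedStoppingTimes 𝓕 :=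
  ⟨fun _ => monotone_const, fun _ _ => continuousWithinAt_const,
    fun _ => const_mem_stoppingTimes t⟩

theorem stopCdf_eq_map (hτ : τ ∈ randomizedStoppingTimes 𝓕) (ω : Ω) (t : Set.Icc (0 : ℝ) T) :
    stopCdf τ ω t = (volume : Measure unitInterval).map (τ ω) (Set.Iic t) :=
  (Measure.map_apply (measurable_section hτ ω) measurableSet_Iic).symm

theorem IsOrliczProcess.exists_coercive [IsProbabilityMeasure μ]
    (h : IsOrliczProcess Φ Y μ) (hΦ : IsDivergenceFunction Φ) :
    ∃ C M : ℝ, 0 ≤ M ∧ (∀ g ∈ randomizedValue Φ Y μ '' randomizedStoppingTimes 𝓕, g 0 ≤ C) ∧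
      ∀ g ∈ randomizedValue Φ Y μ '' randomizedStoppingTimes 𝓕, ∀ x, M < |x| → C ≤ g x := by
  obtain ⟨δ, hδ, c, hc⟩ := h.exists_affine_le_randomizedValue hΦ (𝓕 := 𝓕)
  -- Beyond this radius `δ|x| - c` exceeds the common bound for the values at `0`.
  refine ⟨∫ ω, payoffBound Φ Y 0 ω ∂μ, max 0 ((∫ ω, payoffBound Φ Y 0 ω ∂μ + c) / δ),
    le_max_left _ _, ?_, ?_⟩
  · rintro _ ⟨τ, hτ, rfl⟩
    exact h.randomizedValue_le hΦ hτ 0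
  · rintro _ ⟨τ, hτ, rfl⟩ x hx
    have h1 := (div_lt_iff₀ hδ).1 ((le_max_right _ _).trans_lt hx)
    have h2 := hc τ hτ x
    linarith

theorem IsOrliczProcess.convexOn_of_mem_image [IsFiniteMeasure μ] (h : IsOrliczProcess Φ Y μ)
    (hΦ : IsDivergenceFunction Φ) :
    ∀ g ∈ randomizedValue Φ Y μ '' randomizedStoppingTimes 𝓕, ConvexOn ℝ Set.univ g := by
  rintro _ ⟨τ, hτ, rfl⟩
  exact h.convexOn_randomizedValue hΦ hτ

variable [Fact (0 ≤ T)]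

theorem IsOrliczProcess.convex_image_randomizedValue [IsFiniteMeasure μ]
    (h : IsOrliczProcess Φ Y μ) (hΦ : IsDivergenceFunction Φ) :
    Convex ℝ (randomizedValue Φ Y μ '' randomizedStoppingTimes 𝓕) := by
  rintro _ ⟨τ₁, h₁, rfl⟩ _ ⟨τ₂, h₂, rfl⟩ a b ha hb hab
  lift a to ℝ≥0 using ha
  lift b to ℝ≥0 using hb
  obtain ⟨τ, hτ, hlaw⟩ := exists_mixture h₁ h₂ (a := a) (b := b) (by exact_mod_cast hab)
  exact ⟨τ, hτ, funext fun x => h.randomizedValue_of_map_eq hΦ hτ h₁ h₂ hlaw x⟩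

theorem IsOrliczProcess.minimax [IsProbabilityMeasure μ]
    (h : IsOrliczProcess Φ Y μ) (hΦ : IsDivergenceFunction Φ) :
    (⨆ τ ∈ randomizedStoppingTimes 𝓕, ⨅ x : ℝ, ((randomizedValue Φ Y μ τ x : ℝ) : EReal)) =
      (⨅ x : ℝ, ⨆ τ ∈ randomizedStoppingTimes 𝓕, ((randomizedValue Φ Y μ τ x : ℝ) : EReal)) := by
  obtain ⟨C, M, hM, h0, hC⟩ := h.exists_coercive hΦ (𝓕 := 𝓕)
  have key := iSup_iInf_eq_iInf_iSup_of_convex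
    (Set.Nonempty.image _ ⟨_, const_mem_randomizedStoppingTimes ⊤⟩)
    (h.convex_image_randomizedValue hΦ) (h.convexOn_of_mem_image hΦ) hM h0 hC
  simpa only [iSup_image] using key

/-- From randomized stopping times satisfying `p n`, where each `p n` is stable under mixing with
equal weights, one can select an almost surely convergent sequence. -/
theorem exists_tendsto_of_stable_mixture [IsFiniteMeasure μ] [𝓕.IsRightContinuous]
    {p : ℕ → (Ω → unitInterval → Set.Icc (0 : ℝ) T) → Prop}
    (hanti : ∀ m n, m ≤ n → ∀ τ, p n τ → p m τ)
    (hne : ∀ n, ∃ τ ∈ randomizedStoppingTimes 𝓕, p n τ)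
    (hmix : ∀ n, ∀ τ ∈ randomizedStoppingTimes 𝓕, ∀ τ₁ ∈ randomizedStoppingTimes 𝓕,
      ∀ τ₂ ∈ randomizedStoppingTimes 𝓕, p n τ₁ → p n τ₂ →
      (∀ ω, (volume : Measure unitInterval).map (τ ω) =
        (1 / 2 : ℝ≥0) • (volume : Measure unitInterval).map (τ₁ ω) +
          (1 / 2 : ℝ≥0) • (volume : Measure unitInterval).map (τ₂ ω)) → p n τ) :
    ∃ τs : ℕ → Ω → unitInterval → Set.Icc (0 : ℝ) T,
      (∀ n, τs n ∈ randomizedStoppingTimes 𝓕 ∧ p n (τs n)) ∧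
      ∃ τ ∈ randomizedStoppingTimes 𝓕, ∀ᵐ ω ∂μ, ∀ᵐ u : unitInterval,
        Tendsto (fun n => τs n ω u) atTop (𝓝 (τ ω u)) := by
  let q := TopologicalSpace.denseSeq (Set.Icc (0 : ℝ) T)
  let F : (Ω → unitInterval → Set.Icc (0 : ℝ) T) → Ω × ℕ → ℝ :=
    fun τ z => (stopCdf τ z.1 (q z.2)).toReal
  have hF : ∀ τ ∈ randomizedStoppingTimes 𝓕, Measurable (F τ) := fun τ hτ =>
    measurable_from_prod_countable_left fun k =>
      ((measurable_stopCdf hτ (q k)).mono (𝓕.le _) le_rfl).ennreal_toReal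
  have hF1 : ∀ τ z, |F τ z| ≤ 1 := fun τ z => by
    rw [abs_of_nonneg ENNReal.toReal_nonneg]
    exact ENNReal.toReal_le_of_le_ofReal zero_le_one (by simpa using stopCdf_le_one _ _)
  -- A finite measure equivalent to counting measure handles all dense times at once: almost
  -- everywhere convergence means convergence at every `k`, almost surely.
  obtain ⟨f, hf, hconv⟩ := exists_ae_tendsto_of_midpoint
    (P := μ.prod (Measure.count : Measure ℕ).toFinite)
    (S := fun n => F '' {τ | τ ∈ randomizedStoppingTimes 𝓕 ∧ p n τ})
    (fun m n hmn => Set.image_mono fun τ hτ => ⟨hτ.1, hanti m n hmn τ hτ.2⟩)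
    (fun n => by
      obtain ⟨τ, hτ, hp⟩ := hne n
      exact ⟨_, τ, ⟨hτ, hp⟩, rfl⟩)
    (by rintro n _ ⟨τ, hτ, rfl⟩; exact hF τ hτ.1)
    (by rintro n _ ⟨τ, hτ, rfl⟩; exact hF1 τ)
    (by
      rintro n _ ⟨τ₁, h₁, rfl⟩ _ ⟨τ₂, h₂, rfl⟩
      obtain ⟨τ, hτ, hlaw⟩ := exists_mixture h₁.1 h₂.1 (a := 1 / 2) (b := 1 / 2) (by norm_num)
      refine ⟨τ, ⟨hτ, hmix n τ hτ τ₁ h₁.1 τ₂ h₂.1 h₁.2 h₂.2 hlaw⟩, funext fun z => ?_⟩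
      have h3 : (volume : Measure unitInterval).map (τ z.1) (Set.Iic (q z.2)) =
          ((1 / 2 : ℝ≥0) : ℝ≥0∞) * (volume : Measure unitInterval).map (τ₁ z.1) (Set.Iic (q z.2)) +
          ((1 / 2 : ℝ≥0) : ℝ≥0∞) * (volume : Measure unitInterval).map (τ₂ z.1) (Set.Iic (q z.2)) := by
        rw [hlaw]; rfl
      simp only [F]
      rw [stopCdf_eq_map hτ, h3, ← stopCdf_eq_map h₁.1, ← stopCdf_eq_map h₂.1, ENNReal.toReal_add,
        ENNReal.toReal_mul, ENNReal.toReal_mul]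
      · simp only [ENNReal.coe_toReal]
        push_cast
        ring
      · exact ENNReal.mul_ne_top ENNReal.coe_ne_top
          ((stopCdf_le_one _ _).trans_lt ENNReal.one_lt_top).ne
      · exact ENNReal.mul_ne_top ENNReal.coe_ne_top
          ((stopCdf_le_one _ _).trans_lt ENNReal.one_lt_top).ne)
  choose τs hτs hfτ using hf
  refine ⟨τs, hτs, exists_tendsto_of_tendsto_stopCdf (fun n => (hτs n).1) ?_⟩
  filter_upwards [Measure.ae_ae_of_ae_prod hconv] with ω hω k
  have h1 : ∀ᵐ k ∂(Measure.count : Measure ℕ), ∃ l, Tendsto (fun n => f n (ω, k)) atTop (𝓝 l) :=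
    (absolutelyContinuous_toFinite _).ae_le hω
  obtain ⟨l, hl⟩ := Measure.ae_count_iff.1 h1 k
  refine ⟨ENNReal.ofReal l, ?_⟩
  have h2 := (ENNReal.continuous_ofReal.tendsto l).comp hl
  refine h2.congr fun n => ?_
  simp only [Function.comp_apply, ← hfτ, F]
  exact ENNReal.ofReal_toReal ((stopCdf_le_one _ _).trans_lt ENNReal.one_lt_top).ne

/-- Only for fixed `u` are these stopping times, so the quantifiers over `ω` and `u` are exchanged
by Fubini, which needs the convergence sets measurable. -/
theorem IsQuasiLeftContinuous.ae_prod_tendsto [SFinite μ] [𝓕.IsRightContinuous]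
    (hq : IsQuasiLeftContinuous 𝓕 Y μ) (hY : Adapted 𝓕 Y)
    (hYr : ∀ ω t, ContinuousWithinAt (fun s => Y s ω) (Set.Ici t) t)
    {τs : ℕ → Ω → unitInterval → Set.Icc (0 : ℝ) T}
    (hτs : ∀ n, τs n ∈ randomizedStoppingTimes 𝓕) (hτ : τ ∈ randomizedStoppingTimes 𝓕)
    (hlim : ∀ᵐ ω ∂μ, ∀ᵐ u : unitInterval, Tendsto (fun n => τs n ω u) atTop (𝓝 (τ ω u))) :
    ∀ᵐ p ∂μ.prod (volume : Measure unitInterval),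
      Tendsto (fun n => Y (τs n p.1 p.2) p.1) atTop (𝓝 (Y (τ p.1 p.2) p.1)) := by
  have hmτ := measurable_uncurry_of_mem_randomizedStoppingTimes hτ
  have hmτs := fun n => measurable_uncurry_of_mem_randomizedStoppingTimes (hτs n)
  have hmY := measurable_uncurry_of_adapted hY hYr
  have hYτ : ∀ {σ : Ω → unitInterval → Set.Icc (0 : ℝ) T}, σ ∈ randomizedStoppingTimes 𝓕 →
      Measurable fun p : Ω × unitInterval => Y (σ p.1 p.2) p.1 := fun {σ} hσ => by
    have h1 : Measurable fun p : Ω × unitInterval => (σ p.1 p.2, p.1) :=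
      (measurable_uncurry_of_mem_randomizedStoppingTimes hσ).prodMk measurable_fst
    exact hmY.comp h1
  have hset1 : MeasurableSet {p : Ω × unitInterval |
      Tendsto (fun n => τs n p.1 p.2) atTop (𝓝 (τ p.1 p.2))} :=
    measurableSet_tendsto_fun hmτs hmτ
  have hset2 : MeasurableSet {p : Ω × unitInterval |
      Tendsto (fun n => Y (τs n p.1 p.2) p.1) atTop (𝓝 (Y (τ p.1 p.2) p.1))} :=
    measurableSet_tendsto_fun (fun n => hYτ (hτs n)) (hYτ hτ)
  rw [Measure.ae_prod_iff_ae_ae hset2,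
    Measure.ae_ae_comm (p := fun ω u => Tendsto (fun n => Y (τs n ω u) ω) atTop (𝓝 (Y (τ ω u) ω)))
      hset2]
  filter_upwards [(Measure.ae_ae_comm (p := fun ω u => Tendsto (fun n => τs n ω u) atTop
    (𝓝 (τ ω u))) hset1).1 hlim] with u hu
  exact hq.ae_tendsto hY hYr (fun n => (hτs n).2.2 u) hu

/-- The limit `τ'` has value at least `V` at every `x`, while no `τ` exceeds `V` at `x'`; the two
bounds together give both inequalities. -/
theorem IsOrliczProcess.exists_saddlePoint [IsProbabilityMeasure μ] [𝓕.IsRightContinuous]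
    (h : IsOrliczProcess Φ Y μ) (hΦ : IsDivergenceFunction Φ)
    (hq : IsQuasiLeftContinuous 𝓕 Y μ) (hY : Adapted 𝓕 Y)
    (hYr : ∀ ω t, ContinuousWithinAt (fun s => Y s ω) (Set.Ici t) t) :
    ∃ τ' ∈ randomizedStoppingTimes 𝓕, ∃ x' : ℝ,
      (∀ τ ∈ randomizedStoppingTimes 𝓕,
        randomizedValue Φ Y μ τ x' ≤ randomizedValue Φ Y μ τ' x') ∧
      ∀ x : ℝ, randomizedValue Φ Y μ τ' x' ≤ randomizedValue Φ Y μ τ' x := by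
  obtain ⟨C, M, hM, h0, hC⟩ := h.exists_coercive hΦ (𝓕 := 𝓕)
  obtain ⟨x', V, hV, hVε⟩ := exists_minimizer_of_convex
    (Set.Nonempty.image _ ⟨_, const_mem_randomizedStoppingTimes ⊤⟩)
    (h.convex_image_randomizedValue hΦ) (h.convexOn_of_mem_image hΦ) hM h0 hC fun x =>
    ⟨_, by rintro _ ⟨τ, hτ, rfl⟩; exact h.randomizedValue_le hΦ hτ x⟩
  obtain ⟨τs, hτs, τ', hτ', hlim⟩ := exists_tendsto_of_stable_mixture (μ := μ) (𝓕 := 𝓕)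
    -- A lower bound on the value at each `x` survives mixing, since the value is affine in the law.
    (p := fun n τ => ∀ x, V - 1 / ((n : ℝ) + 1) ≤ randomizedValue Φ Y μ τ x)
    (fun m n hmn τ hτ x => (sub_le_sub_left (one_div_le_one_div_of_le (by positivity)
      (by gcongr)) V).trans (hτ x))
    (fun n => by
      obtain ⟨_, ⟨τ, hτ, rfl⟩, hx⟩ := hVε (1 / ((n : ℝ) + 1)) (by positivity)
      exact ⟨τ, hτ, hx⟩)
    (fun n τ hτ τ₁ h₁ τ₂ h₂ hp₁ hp₂ hlaw x => by
      rw [h.randomizedValue_of_map_eq hΦ hτ h₁ h₂ hlaw x]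
      push_cast
      linarith [hp₁ x, hp₂ x])
  have hlim' := hq.ae_prod_tendsto hY hYr (fun n => (hτs n).1) hτ' hlim
  have hge : ∀ x, V ≤ randomizedValue Φ Y μ τ' x := fun x => by
    have h1 : Tendsto (fun n : ℕ => V - 1 / ((n : ℝ) + 1)) atTop (𝓝 (V - 0)) :=
      tendsto_const_nhds.sub tendsto_one_div_add_atTop_nhds_zero_nat
    rw [sub_zero] at h1
    exact le_of_tendsto_of_tendsto' h1
      (h.tendsto_randomizedValue hΦ (fun n => (hτs n).1) hlim' x) fun n => (hτs n).2 x
  exact ⟨τ', hτ', x', fun τ hτ => (hV _ ⟨τ, hτ, rfl⟩).trans (hge x'),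
    fun x => (hV _ ⟨τ', hτ', rfl⟩).trans (hge x)⟩

end SaddlePoint

theorem proposition6p2 {Ω : Type*} {mΩ : MeasurableSpace Ω} (μ : Measure Ω) [IsProbabilityMeasure μ]
    (T : ℝ) (hT : 0 < T) (𝓕 : Filtration (Set.Icc (0 : ℝ) T) mΩ)
    -- the filtration: right-continuous, trivial at time `0`, containing all null sets
    (h𝓕 : 𝓕.IsRightContinuous)
    (h𝓕_zero : ∀ A, MeasurableSet[𝓕 ⟨0, Set.left_mem_Icc.2 hT.le⟩] A → μ A = 0 ∨ μ A = 1)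
    (h𝓕_null : ∀ A, MeasurableSet A → μ A = 0 →
      MeasurableSet[𝓕 ⟨0, Set.left_mem_Icc.2 hT.le⟩] A)
    (Φ : ℝ≥0 → ℝ≥0∞) (hΦ : IsDivergenceFunction Φ)
    -- the process: adapted, nonnegative, right-continuous
    (Y : Set.Icc (0 : ℝ) T → Ω → ℝ) (hY_adapted : Adapted 𝓕 Y) (hY_nonneg : ∀ t ω, 0 ≤ Y t ω)
    (hY_right : ∀ ω t, ContinuousWithinAt (fun s => Y s ω) (Set.Ici t) t)
    -- the supremum is an (almost surely finite) random variable in the Orlicz heart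
    (hY_bdd : ∀ᵐ ω ∂μ, BddAbove (Set.range fun t => Y t ω))
    (hY_heart : MemOrliczHeart (youngConj Φ) (fun ω => ⨆ t, Y t ω) μ) :
    (∀ τ ∈ randomizedStoppingTimes 𝓕, ∀ x : ℝ,
      Integrable (randomizedPayoff Φ Y τ x) (μ.prod (volume : Measure unitInterval))) ∧
    (⨆ τ ∈ randomizedStoppingTimes 𝓕, ⨅ x : ℝ, ((randomizedValue Φ Y μ τ x : ℝ) : EReal)) =
      (⨅ x : ℝ, ⨆ τ ∈ randomizedStoppingTimes 𝓕, ((randomizedValue Φ Y μ τ x : ℝ) : EReal)) ∧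
    (IsQuasiLeftContinuous 𝓕 Y μ →
      @MeasurableSpace.CountablyGenerated Ω (𝓕 ⟨T, Set.right_mem_Icc.2 hT.le⟩) →
      ∃ τ' ∈ randomizedStoppingTimes 𝓕, ∃ x' : ℝ,
        (∀ τ ∈ randomizedStoppingTimes 𝓕,
          randomizedValue Φ Y μ τ x' ≤ randomizedValue Φ Y μ τ' x') ∧
        ∀ x : ℝ, randomizedValue Φ Y μ τ' x' ≤ randomizedValue Φ Y μ τ' x) := by
  have : Fact (0 ≤ T) := ⟨hT.le⟩
  have h : IsOrliczProcess Φ Y μ :=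
    ⟨measurable_uncurry_of_adapted hY_adapted hY_right, hY_nonneg, hY_bdd, hY_heart⟩
  exact ⟨fun τ hτ x => h.integrable_randomizedPayoff hΦ hτ x, h.minimax hΦ,
    fun hq _ => h.exists_saddlePoint hΦ hq hY_adapted hY_right⟩
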